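/- **Setting.** Let $V$ and $H$ be real Hilbert spaces, $V\subset H$, the inclusion being continuous, dense and compact, and identify $H=H'$, so that $V\subset H\subset V'$. Let $A\in\mathcal L(V,V')$ be symmetric and such that $(y,z)\mapsto\langle Ay,z\rangle$ is a complete scalar product on $V$. Endow $V$ with the scalar product $(y,z)_V=\langle Ay,z\rangle$, $V'$ with the corresponding dual norm, $\mathrm D(A)=\{v\in V\mid Av\in H\}$ with the norm $\|v\|_{\mathrm D(A)}=\|Av\|_H$, and $\mathrm D(A)'\supset V'$ with the corresponding dual norm. Then $A:\mathrm D(A)\to H$ is bijective, with inverse $A^{-1}$, and $A$ extends to $A: H\to \mathrm D(A)'$ by $\langle Ah,v\rangle=(h,Av)_H$. For an open interval $I$ put $W(I,X,Y)=\{f\in L^2(I,X)\mid \dot f\in L^2(I,Y)\}$, with $\dot f$ the distributional derivative. Let $\sigma:\mathbb N_+\to\mathbb N_+$ be strictly increasing, and for each $M\in\mathbb N_+$ let $\mathfrak d^{M,j}\in \mathrm D(A)'$, $1\le j\le M_\sigma:=\sigma(M)$, span a space of dimension $M_\sigma$. Suppose that for each $M$ there are $\Psi^{M,j}\in \mathrm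 D(A)$, $1\le j\le M_\sigma$, spanning a space of dimension $M_\sigma$, with $\langle\mathfrak d^{M,j},\Psi^{M,i}\rangle=1$ if $i=j$ and $=0$ if $i\neq j$, and that $$\xi_{M_+}:=\inf\Big\{\tfrac{\|\varTheta\|_{\mathrm D(A)}^2}{\|\varTheta\|_V^2}\;\Big|\;0\ne\varTheta\in \mathrm D(A),\ \langle\mathfrak d^{M,j},\varTheta\rangle=0\text{ for all }1\le j\le M_\sigma\Big\}\ \longrightarrow\ +\infty\qquad(M\to+\infty).$$ **Theorem.** There are functions $(\mu,C)\mapsto\overline M(\mu,C)\in\mathbb N_+$ and $(M,\mu,C)\mapsto\overline\lambda(M,\mu,C)\in(0,\infty)$, for $\mu,C\in[0,\infty)$ and $M\in\mathbb N_+$, nondecreasing in each of their arguments (and depending on nothing but $V,H,A$ and the actuators $\mathfrak d^{M,j}$), such that the following holds for every $\mu>0$ and $C_{\rm rc}\ge0$. Let $A_{\rm rc}(t)\in\mathcal L(H,V')$, $t>0$, be such that $t\mapsto\langle A_{\rm rc}(t)h,v\rangle$ is measurable for all $h\in H$, $v\in V$, and $\|A_{\rm rc}(t)\|_{\mathcal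 L(H,V')}\le C_{\rm rc}$ for almost every $t>0$. Let $M\ge\overline M(\mu,C_{\rm rc})$ and $\lambda\ge\overline\lambda(M,\mu,C_{\rm rc})$. Then, for every $y_0\in V'$, the system $$\dot y+Ay+A_{\rm rc}y=-\lambda\sum_{j=1}^{M_\sigma}\langle\mathfrak d^{M,j},A^{-1}y\rangle\,\mathfrak d^{M,j},\qquad y(0)=y_0,$$ has a unique solution $y\in C([0,\infty),V')$ which lies in $W((0,\tau),H,\mathrm D(A)')$ for all $\tau>0$ (the equation being understood in $\mathrm D(A)'$ for almost every $t>0$). This solution satisfies $y\in W((0,\infty),H,\mathrm D(A)')$, $$\|y(t)\|_{V'}\le \mathrm e^{-\mu(t-s)}\|y(s)\|_{V'}\quad\text{for all }t\ge s\ge0,$$ $$\|y\|_{L^2((s,\infty),H)}^2\le\big(2+\mu^{-1}C_{\rm rc}^2\big)\|y(s)\|_{V'}^2\quad\text{for all }s\ge0.$$ In particular one may take $M=\overline M(\mu,C_{\rm rc})$ and $\lambda=\overline\lambda(\overline M(\mu,C_{\rm rc}),\mu,C_{\rm rc})$, which are nondecreasing functions of $(\mu,C_{\rm rc})$. -/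

import Mathlib

open MeasureTheory Set Filter Topology
open scoped NNReal ContDiff

/-- A diffusion-like operator `A` in the Gelfand triple `V ⊆ H = H' ⊆ V'`: the Hilbert space `V` is
injected by `incl` continuously, densely and compactly into the Hilbert space `H`, and
`A ∈ L(V, V')` is symmetric and such that `(y, z) ↦ ⟨A y, z⟩` is a complete scalar product on `V`. -/
structure DiffusionOperator (V H : Type*)
    [NormedAddCommGroup V] [InnerProductSpace ℝ V] [CompleteSpace V]
    [NormedAddCommGroup H] [InnerProductSpace ℝ H] [CompleteSpace H] where
  incl : V →L[ℝ] H
  incl_injective : Function.Injective incl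
  incl_denseRange : DenseRange incl
  incl_compact : IsCompactOperator incl
  A : V →L[ℝ] StrongDual ℝ V
  symm : ∀ y z : V, A y z = A z y
  pos : ∀ y : V, y ≠ 0 → 0 < A y y
  complete : ∀ u : ℕ → V,
    (∀ ε : ℝ, 0 < ε → ∃ N : ℕ, ∀ m n : ℕ, N ≤ m → N ≤ n → A (u m - u n) (u m - u n) < ε) →
    ∃ v : V, Tendsto (fun n => A (u n - v) (u n - v)) atTop (𝓝 0)

namespace DiffusionOperator

variable {V H : Type*}
  [NormedAddCommGroup V] [InnerProductSpace ℝ V] [CompleteSpace V]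
  [NormedAddCommGroup H] [InnerProductSpace ℝ H] [CompleteSpace H]

/-- The space `V`, endowed with the scalar product `(y, z)_V = ⟨A y, z⟩`. -/
def Energy (_T : DiffusionOperator V H) : Type _ := V

/-- The scalar product `(y, z)_V = ⟨A y, z⟩`. -/
@[reducible] noncomputable def energyCore (T : DiffusionOperator V H) :
    InnerProductSpace.Core ℝ V where
  inner y z := T.A y z
  conj_inner_symm y z := by simpa using T.symm _ _
  re_inner_nonneg y := by
    by_cases h : y = 0
    · simp [h]
    · simpa using (T.pos _ h).le
  add_left x y z := by simp
  smul_left x y r := by simp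
  definite y h := by
    by_contra hy
    exact (T.pos y hy).ne' h

noncomputable instance (T : DiffusionOperator V H) : NormedAddCommGroup T.Energy :=
  @InnerProductSpace.Core.toNormedAddCommGroup ℝ V _ _ _ T.energyCore

noncomputable instance (T : DiffusionOperator V H) : InnerProductSpace ℝ T.Energy :=
  @InnerProductSpace.ofCore ℝ V _ _ _ T.energyCore.toCore

/-- The identity, from `V` with the scalar product `⟨A y, z⟩` to `V` with its original one. -/
def ofEnergy (T : DiffusionOperator V H) : T.Energy ≃ₗ[ℝ] V where
  toFun v := v
  invFun v := v
  map_add' _ _ := rfl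
  map_smul' _ _ := rfl
  left_inv _ := rfl
  right_inv _ := rfl

theorem energy_inner (T : DiffusionOperator V H) (y z : T.Energy) :
    inner ℝ y z = T.A (T.ofEnergy y) (T.ofEnergy z) := rfl

theorem energy_norm_sq (T : DiffusionOperator V H) (y : T.Energy) :
    ‖y‖ ^ 2 = T.A (T.ofEnergy y) (T.ofEnergy y) := by
  rw [← real_inner_self_eq_norm_sq, energy_inner]

instance (T : DiffusionOperator V H) : CompleteSpace T.Energy := by
  apply Metric.complete_of_cauchySeq_tendsto
  intro u hu
  obtain ⟨v, hv⟩ := T.complete (fun n => T.ofEnergy (u n)) (by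
    intro ε hε
    obtain ⟨N, hN⟩ := Metric.cauchySeq_iff.1 hu (Real.sqrt ε) (Real.sqrt_pos.2 hε)
    refine ⟨N, fun m n hm hn => ?_⟩
    have h1 := hN m hm n hn
    rw [dist_eq_norm] at h1
    have h2 := T.energy_norm_sq (u m - u n)
    rw [map_sub] at h2
    rw [← h2]
    exact (Real.lt_sqrt (norm_nonneg _)).1 h1)
  refine ⟨T.ofEnergy.symm v, ?_⟩
  rw [tendsto_iff_norm_sub_tendsto_zero]
  have h3 : (fun n => ‖u n - T.ofEnergy.symm v‖)
      = fun n => Real.sqrt (T.A (T.ofEnergy (u n) - v) (T.ofEnergy (u n) - v)) := by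
    funext n
    rw [← Real.sqrt_sq (norm_nonneg (u n - T.ofEnergy.symm v)), T.energy_norm_sq, map_sub,
      LinearEquiv.apply_symm_apply]
  rw [h3]
  have h4 := (Real.continuous_sqrt.tendsto 0).comp hv
  rwa [Real.sqrt_zero] at h4

theorem continuous_ofEnergy_symm (T : DiffusionOperator V H) : Continuous T.ofEnergy.symm := by
  refine AddMonoidHomClass.continuous_of_bound T.ofEnergy.symm (Real.sqrt ‖T.A‖) fun v => ?_
  refine le_of_sq_le_sq ?_ (by positivity)
  rw [T.energy_norm_sq, LinearEquiv.apply_symm_apply, mul_pow,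
    Real.sq_sqrt (norm_nonneg T.A), sq, ← mul_assoc]
  exact (le_abs_self _).trans (T.A.le_opNorm₂ v v)

/-- The two norms of `V` are equivalent. -/
theorem continuous_ofEnergy (T : DiffusionOperator V H) : Continuous T.ofEnergy :=
  T.ofEnergy.symm.toContinuousLinearEquivOfContinuous T.continuous_ofEnergy_symm
    |>.symm.continuous

/-- The inclusion `V ⊆ H`, for the scalar product `⟨A y, z⟩` on `V`. -/
noncomputable def VtoH (T : DiffusionOperator V H) : T.Energy →L[ℝ] H :=
  T.incl.comp ⟨T.ofEnergy.toLinearMap, T.continuous_ofEnergy⟩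

/-- The dual `V'`, with the dual norm of `‖y‖_V = ⟨A y, y⟩^(1/2)`. -/
abbrev DualV (T : DiffusionOperator V H) : Type _ := StrongDual ℝ T.Energy

/-- The inclusion `H = H' ⊆ V'`, that is `⟨h, v⟩_{V',V} = (h, v)_H`. -/
noncomputable def HtoDualV (T : DiffusionOperator V H) : H →L[ℝ] T.DualV :=
  (ContinuousLinearMap.compL ℝ T.Energy H ℝ).flip T.VtoH ∘L innerSL ℝ

theorem HtoDualV_apply (T : DiffusionOperator V H) (h : H) (v : T.Energy) :
    T.HtoDualV h v = inner ℝ h (T.incl (T.ofEnergy v)) := rfl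

/-- The domain `{v ∈ V | A v ∈ H}` of `A` as an operator in `H`. -/
def domain (T : DiffusionOperator V H) : Submodule ℝ V where
  carrier := {v | ∃ h : H, ∀ w : V, T.A v w = inner ℝ h (T.incl w)}
  zero_mem' := ⟨0, by simp⟩
  add_mem' := by
    rintro a b ⟨h, hh⟩ ⟨k, hk⟩
    exact ⟨h + k, fun w => by simp [hh, hk, inner_add_left]⟩
  smul_mem' := by
    rintro c a ⟨h, hh⟩
    exact ⟨c • h, fun w => by simp [hh, real_inner_smul_left]⟩

/-- The domain `D(A)` as a space of its own; its norm is `‖A v‖_H`, see below. -/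
def Dom (T : DiffusionOperator V H) : Type _ := T.domain

instance (T : DiffusionOperator V H) : AddCommGroup T.Dom := inferInstanceAs (AddCommGroup T.domain)

instance (T : DiffusionOperator V H) : Module ℝ T.Dom := inferInstanceAs (Module ℝ T.domain)

/-- The inclusion `D(A) ⊆ V`, as a linear map. -/
def domVal (T : DiffusionOperator V H) : T.Dom →ₗ[ℝ] V := T.domain.subtype

theorem domVal_injective (T : DiffusionOperator V H) : Function.Injective T.domVal :=
  Subtype.val_injective

theorem exists_domA (T : DiffusionOperator V H) (v : T.Dom) :
    ∃ h : H, ∀ w : V, T.A (T.domVal v) w = inner ℝ h (T.incl w) := v.2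

theorem eq_of_inner_incl (T : DiffusionOperator V H) {h k : H}
    (e : ∀ w : V, inner ℝ h (T.incl w) = inner ℝ k (T.incl w)) : h = k :=
  T.incl_denseRange.eq_of_inner_left ℝ e

/-- The operator `A : D(A) → H`, characterised by `(A v, w)_H = ⟨A v, w⟩_{V',V}` for all `w ∈ V`. -/
noncomputable def domA (T : DiffusionOperator V H) : T.Dom →ₗ[ℝ] H where
  toFun v := (T.exists_domA v).choose
  map_add' u v := T.eq_of_inner_incl fun w => by
    rw [inner_add_left, ← (T.exists_domA (u + v)).choose_spec, ← (T.exists_domA u).choose_spec,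
      ← (T.exists_domA v).choose_spec]
    simp
  map_smul' c v := T.eq_of_inner_incl fun w => by
    rw [RingHom.id_apply, real_inner_smul_left, ← (T.exists_domA (c • v)).choose_spec,
      ← (T.exists_domA v).choose_spec]
    simp

theorem inner_domA (T : DiffusionOperator V H) (v : T.Dom) (w : V) :
    inner ℝ (T.domA v) (T.incl w) = T.A (T.domVal v) w := ((T.exists_domA v).choose_spec w).symm

theorem domA_injective (T : DiffusionOperator V H) : Function.Injective T.domA := by
  rw [injective_iff_map_eq_zero]
  intro v hv
  apply T.domVal_injective
  rw [map_zero]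
  by_contra hne
  have := T.pos _ hne
  rw [← T.inner_domA, hv, inner_zero_left] at this
  exact lt_irrefl _ this

theorem domA_surjective (T : DiffusionOperator V H) : Function.Surjective T.domA := by
  intro h
  let v : T.Energy := (InnerProductSpace.toDual ℝ T.Energy).symm (T.HtoDualV h)
  have hv : ∀ w : V, T.A (T.ofEnergy v) w = inner ℝ h (T.incl w) := fun w =>
    InnerProductSpace.toDual_symm_apply (𝕜 := ℝ) (x := T.ofEnergy.symm w) (y := T.HtoDualV h)
  refine ⟨(⟨T.ofEnergy v, h, hv⟩ : T.domain), T.eq_of_inner_incl fun w => ?_⟩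
  rw [← hv]
  exact T.inner_domA _ w

/-- `D(A)` is endowed with the norm `‖v‖_{D(A)} = ‖A v‖_H`. -/
noncomputable instance (T : DiffusionOperator V H) : NormedAddCommGroup T.Dom :=
  NormedAddCommGroup.induced T.Dom H T.domA T.domA_injective

noncomputable instance (T : DiffusionOperator V H) : NormedSpace ℝ T.Dom :=
  NormedSpace.induced ℝ T.Dom H T.domA

/-- The isometry `A : D(A) → H`; its inverse is `A⁻¹ : H → D(A)`. -/
noncomputable def domAEquiv (T : DiffusionOperator V H) : T.Dom ≃ₗᵢ[ℝ] H where
  toLinearEquiv := LinearEquiv.ofBijective T.domA ⟨T.domA_injective, T.domA_surjective⟩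
  norm_map' _ := rfl

theorem energy_norm_dom_le (T : DiffusionOperator V H) (v : T.Dom) :
    ‖T.ofEnergy.symm (T.domVal v)‖ ≤ ‖T.VtoH‖ * ‖v‖ := by
  have h1 := T.energy_norm_sq (T.ofEnergy.symm (T.domVal v))
  rw [LinearEquiv.apply_symm_apply, ← T.inner_domA] at h1
  have h2 := real_inner_le_norm (T.domA v) (T.incl (T.domVal v))
  have h3 : ‖T.incl (T.domVal v)‖ ≤ ‖T.VtoH‖ * ‖T.ofEnergy.symm (T.domVal v)‖ :=
    T.VtoH.le_opNorm (T.ofEnergy.symm (T.domVal v))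
  have h4 : ‖T.domA v‖ = ‖v‖ := rfl
  rw [h4] at h2
  set a := ‖T.ofEnergy.symm (T.domVal v)‖
  have ha : 0 ≤ a := norm_nonneg _
  have h5 : ‖v‖ * ‖T.incl (T.domVal v)‖ ≤ ‖v‖ * (‖T.VtoH‖ * a) :=
    mul_le_mul_of_nonneg_left h3 (norm_nonneg _)
  rcases ha.eq_or_lt with h0 | h0
  · rw [← h0]; positivity
  · refine le_of_mul_le_mul_right ?_ h0
    nlinarith

/-- The inclusion `D(A) ⊆ V`. -/
noncomputable def domToV (T : DiffusionOperator V H) : T.Dom →L[ℝ] T.Energy :=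
  (T.ofEnergy.symm.toLinearMap ∘ₗ T.domVal).mkContinuous ‖T.VtoH‖ T.energy_norm_dom_le

/-- The dual `D(A)'`, with the dual norm of `‖v‖_{D(A)} = ‖A v‖_H`. -/
abbrev DualDom (T : DiffusionOperator V H) : Type _ := StrongDual ℝ T.Dom

/-- The inclusion `V' ⊆ D(A)'`, that is `⟨f, v⟩_{D(A)',D(A)} = ⟨f, v⟩_{V',V}`. -/
noncomputable def dualVToDualDom (T : DiffusionOperator V H) : T.DualV →L[ℝ] T.DualDom :=
  (ContinuousLinearMap.compL ℝ T.Dom T.Energy ℝ).flip T.domToV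

/-- The inclusion `H ⊆ D(A)'`. -/
noncomputable def HtoDualDom (T : DiffusionOperator V H) : H →L[ℝ] T.DualDom :=
  T.dualVToDualDom ∘L T.HtoDualV

/-- The extension `A : H → D(A)'` of `A`, that is `⟨A h, v⟩_{D(A)',D(A)} = (h, A v)_H`. -/
noncomputable def AHtoDualDom (T : DiffusionOperator V H) : H →L[ℝ] T.DualDom :=
  (ContinuousLinearMap.compL ℝ T.Dom H ℝ).flip
    (T.domAEquiv.toContinuousLinearEquiv : T.Dom →L[ℝ] H) ∘L innerSL ℝ

/-- On `V`, the extension agrees with `A : V → V' ⊆ D(A)'`. -/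
theorem AHtoDualDom_incl (T : DiffusionOperator V H) (v : V) (w : T.Dom) :
    T.AHtoDualDom (T.incl v) w = T.A v (T.domVal w) := by
  rw [T.symm, ← T.inner_domA, real_inner_comm]
  rfl

/-- The Poincaré-type constant `ξ` of the functionals `d₁, …, dₙ ∈ D(A)'`: the infimum of
`‖Θ‖²_{D(A)} / ‖Θ‖²_V` over the `Θ ≠ 0` in `D(A)` that all `dⱼ` annihilate. -/
noncomputable def poincareConst (T : DiffusionOperator V H) {n : ℕ} (d : Fin n → T.DualDom) : ℝ :=
  ⨅ Θ : {Θ : T.Dom // (∀ j, d j Θ = 0) ∧ Θ ≠ 0}, ‖Θ.1‖ ^ 2 / ‖T.domToV Θ.1‖ ^ 2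

/-- The assumptions on the sequence `U_M = {d^{M,j} | 1 ≤ j ≤ σ(M)}`, `M ∈ ℕ₊`, of families of
actuators. -/
structure IsActuatorSequence (T : DiffusionOperator V H) (σ : ℕ+ → ℕ+)
    (d : (M : ℕ+) → Fin (σ M) → T.DualDom) : Prop where
  strictMono : StrictMono σ
  finrank_span : ∀ M, Module.finrank ℝ (Submodule.span ℝ (range (d M))) = σ M
  exists_auxiliary : ∃ Ψ : (M : ℕ+) → Fin (σ M) → T.Dom,
    (∀ M, Module.finrank ℝ (Submodule.span ℝ (range (Ψ M))) = σ M) ∧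
    ∀ M i j, d M j (Ψ M i) = if j = i then 1 else 0
  tendsto_poincareConst : Tendsto (fun M => T.poincareConst (d M)) atTop atTop

/-- `A_rc(t) ∈ L(H, V')`, `t > 0`, is (weakly) measurable in time, and its norm in
`L^∞((0,∞), L(H, V'))` is at most `C`. -/
structure IsReactionConvection (T : DiffusionOperator V H) (Arc : ℝ → H →L[ℝ] T.DualV) (C : ℝ) :
    Prop where
  aemeasurable : ∀ (h : H) (v : T.Energy),
    AEMeasurable (fun t => Arc t h v) (volume.restrict (Ioi 0))
  bound : ∀ᵐ t ∂(volume.restrict (Ioi (0 : ℝ))), ‖Arc t‖ ≤ C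

end DiffusionOperator

/-- `g` is the derivative of `f` in the sense of (vector-valued) distributions on the open set
`I ⊆ ℝ`. -/
def IsDistribDeriv {Y : Type*} [NormedAddCommGroup Y] [NormedSpace ℝ Y]
    (I : Set ℝ) (f g : ℝ → Y) : Prop :=
  ∀ φ : ℝ → ℝ, ContDiff ℝ ∞ φ → HasCompactSupport φ → tsupport φ ⊆ I →
    ∫ t in I, deriv φ t • f t = -∫ t in I, φ t • g t

/-- Membership of `f` in `W(I, X, Y) = {f ∈ L²(I, X) | f' ∈ L²(I, Y)}`, for `X ⊆ Y` with
inclusion `i`. -/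
def MemW {X Y : Type*} [NormedAddCommGroup X] [NormedSpace ℝ X] [NormedAddCommGroup Y]
    [NormedSpace ℝ Y] (i : X →L[ℝ] Y) (I : Set ℝ) (f : ℝ → X) : Prop :=
  MemLp f 2 (volume.restrict I) ∧
    ∃ g : ℝ → Y, MemLp g 2 (volume.restrict I) ∧ IsDistribDeriv I (fun t => i (f t)) g

namespace DiffusionOperator

variable {V H : Type*}
  [NormedAddCommGroup V] [InnerProductSpace ℝ V] [CompleteSpace V]
  [NormedAddCommGroup H] [InnerProductSpace ℝ H] [CompleteSpace H]

/-- `y` is a solution on `(0, ∞)` of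
`y' + A y + A_rc y = -λ ∑ⱼ ⟨dⱼ, A⁻¹ y⟩ dⱼ`, `y(0) = y₀ ∈ V'`.
It is in `W((0,τ), H, D(A)')` for all `τ > 0`, and the equation holds in `D(A)'` for almost every
time. The functions `y` and `yH` are two representatives of the same class: `y` is the continuous
`V'`-valued one, which gives the values `y(t) ∈ V'` at every time, and `yH` is an `H`-valued one. -/
structure IsSolution (T : DiffusionOperator V H) (Arc : ℝ → H →L[ℝ] T.DualV) (lam : ℝ)
    {n : ℕ} (d : Fin n → T.DualDom) (y₀ : T.DualV) (y : ℝ → T.DualV) (yH : ℝ → H) : Prop where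
  continuousOn : ContinuousOn y (Ici 0)
  initial : y 0 = y₀
  ae_eq : ∀ᵐ t ∂(volume.restrict (Ioi (0 : ℝ))), y t = T.HtoDualV (yH t)
  memLp : ∀ τ : ℝ, 0 < τ → MemLp yH 2 (volume.restrict (Ioo 0 τ))
  equation : ∃ y' : ℝ → T.DualDom,
    (∀ τ : ℝ, 0 < τ → MemLp y' 2 (volume.restrict (Ioo 0 τ))) ∧
    IsDistribDeriv (Ioi 0) (fun t => T.HtoDualDom (yH t)) y' ∧
    ∀ᵐ t ∂(volume.restrict (Ioi (0 : ℝ))),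
      y' t + T.AHtoDualDom (yH t) + T.dualVToDualDom (Arc t (yH t))
        = -(lam • ∑ j, d j (T.domAEquiv.symm (yH t)) • d j)

end DiffusionOperator

/-! The natural energy is `‖y‖²` in `V'`. Riesz isomorphisms turn the system into one in `H`. Write
`ι` for `V ⊆ H`, with `V` carrying `⟨A·,·⟩`. Then `y ∈ V'` becomes `z = A⁻¹y ∈ V`, with the same
norm, and `z = ι* u` when `y = u ∈ H`; the space `D(A)'` becomes `H`, with `A : H → D(A)'` turned
into the identity and the actuators into vectors `δⱼ ∈ H`. The equation reads `(ι z)' + N(t) u = 0`,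
where `N = 1 + ι R + λ ∑ (δⱼ, ·) δⱼ` and `R` represents `A_rc`.

Everything follows from the coercivity `(N h, h) ≥ ¼‖h‖² + μ‖ι* h‖²`. By Young's inequality the term
with `R` costs `¼‖h‖² + C²‖ι* h‖²`, so `(C² + μ)‖ι* h‖²` has to be absorbed by half of `‖h‖²` and
the feedback (`mul_norm_sq_le_of_biorthogonal`). Split `h` by the oblique projection given by the
vectors `AΨᵢ`, which are biorthogonal to the `δⱼ`. The part unseen by the actuators is small in `V`,
because the Poincaré constant is large for large `M`; the seen part is controlled by the feedback
once `λ` is large.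

The energy identity `(‖z‖²)' = 2 (u, (ι z)')` (`norm_sq_sub_norm_sq_eq_integral`) and coercivity
give the decay and the bound in `L²(H)` (`energy_estimates`). By linearity they also give
uniqueness. Existence comes from Lions' representation theorem on the whole half-line
(`exists_memLp_primitive_eq`), followed by regularity (`exists_continuous_representative`). Both the
energy identity and the regularity are proved coordinatewise, in orthonormal bases of `H` and `V`
that diagonalise the compact map `ι`; a weight lost in one factor is regained in the other. -/

/-! ### Calculus of primitives of integrable functions. -/

theorem IntervalIntegrable.ae_deriv_primitive_eq {p : ℝ → ℝ} {a b c : ℝ}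
    (hp : IntervalIntegrable p volume a b) :
    ∀ᵐ x, x ∈ uIcc a b → deriv (fun t => c + ∫ r in a..t, p r) x = p x := by
  filter_upwards [hp.ae_hasDerivAt_integral] with x hx hx'
  exact ((hx hx' a (by simp)).const_add c).deriv

/-- The product rule for two functions that are primitives of integrable functions. -/
theorem mul_sub_mul_eq_integral_of_primitive {f g p q : ℝ → ℝ} {a b : ℝ} (hab : a ≤ b)
    (hp : IntervalIntegrable p volume a b) (hq : IntervalIntegrable q volume a b)
    (hf : ∀ t ∈ Icc a b, f t = f a + ∫ r in a..t, p r)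
    (hg : ∀ t ∈ Icc a b, g t = g a + ∫ r in a..t, q r) :
    f b * g b - f a * g a = ∫ r in a..b, p r * g r + f r * q r := by
  have ac : ∀ {p : ℝ → ℝ} (c : ℝ), IntervalIntegrable p volume a b →
      AbsolutelyContinuousOnInterval (fun t => c + ∫ r in a..t, p r) a b := by
    intro p c hp
    refine AbsolutelyContinuousOnInterval.fun_add ?_
      (hp.absolutelyContinuousOnInterval_intervalIntegral (by simp))
    exact (LipschitzWith.const c).lipschitzOnWith.absolutelyContinuousOnInterval
  -- The product rule is applied to the explicit primitives, since `f` and `g` are only known on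
  -- `[a, b]`.
  have h := (ac (f a) hp).integral_deriv_mul_eq_sub (ac (g a) hq)
  simp only [intervalIntegral.integral_same, add_zero] at h
  rw [hf b (right_mem_Icc.2 hab), hg b (right_mem_Icc.2 hab), ← h]
  apply intervalIntegral.integral_congr_ae
  filter_upwards [hp.ae_deriv_primitive_eq (c := f a), hq.ae_deriv_primitive_eq (c := g a)]
    with x h1 h2 hx
  have hx' := uIoc_subset_uIcc hx
  rw [h1 hx', h2 hx']
  rw [uIcc_of_le hab] at hx'
  rw [hf x hx', hg x hx']

/-- The increment of the square of a primitive of `s⁻¹ q` that is almost everywhere `s p`. -/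
theorem sq_sub_sq_eq_integral_of_primitive {f p q : ℝ → ℝ} {a b s : ℝ} (hs : 0 < s) (hab : a ≤ b)
    (hq : IntervalIntegrable q volume a b)
    (hf : ∀ t ∈ Icc a b, f t = f a + ∫ r in a..t, s⁻¹ * q r)
    (hp : ∀ᵐ t ∂(volume.restrict (Ioc a b)), f t = s * p t) :
    f b ^ 2 - f a ^ 2 = ∫ r in a..b, 2 * (p r * q r) := by
  rw [sq, sq, mul_sub_mul_eq_integral_of_primitive hab (hq.const_mul _) (hq.const_mul _) hf hf,
    intervalIntegral.integral_of_le hab, intervalIntegral.integral_of_le hab]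
  refine integral_congr_ae ?_
  filter_upwards [hp] with t ht
  rw [ht]
  field_simp
  ring

/-- Freezing the upper limit at `0` gives a function continuous on all of `ℝ` although nothing is
known of `g` at negative times. -/
theorem continuous_integral_max_zero {F : Type*} [NormedAddCommGroup F] [NormedSpace ℝ F]
    {g : ℝ → F} (hg : ∀ τ, 0 < τ → IntegrableOn g (Ioc 0 τ)) :
    Continuous fun t => ∫ r in (0 : ℝ)..max t 0, g r := by
  have h1 : ∀ a b, IntervalIntegrable ((Ioi 0).indicator g) volume a b := by
    intro a b
    rw [intervalIntegrable_iff, IntegrableOn, integrable_indicator_iff measurableSet_Ioi,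
      IntegrableOn, Measure.restrict_restrict measurableSet_Ioi]
    refine (hg (max (max a b) 1) (by simp)).mono_set ?_
    rintro x ⟨hx, hx'⟩
    exact ⟨hx, (hx'.2).trans (le_max_left _ _)⟩
  have h2 := (intervalIntegral.continuous_primitive h1 0).comp
    (continuous_id.max (continuous_const (y := (0 : ℝ))))
  refine (continuous_congr fun t => ?_).1 (h2 : Continuous fun t => _)
  simp only [Function.comp, id]
  rw [intervalIntegral.integral_of_le (le_max_right _ _),
    intervalIntegral.integral_of_le (le_max_right _ _)]
  exact setIntegral_congr_fun measurableSet_Ioc fun x hx => indicator_of_mem (mem_Ioi.2 hx.1) g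

/-- A form of Gronwall's inequality: if `f` is a primitive of `p ≤ -k f`, then `f` decays
exponentially at rate `k`. -/
theorem le_exp_mul_of_primitive_le {f p : ℝ → ℝ} {a b k : ℝ} (hab : a ≤ b)
    (hp : IntervalIntegrable p volume a b)
    (hf : ∀ t ∈ Icc a b, f t = f a + ∫ r in a..t, p r)
    (hle : ∀ᵐ r ∂(volume.restrict (Ioc a b)), p r ≤ -k * f r) :
    f b ≤ Real.exp (-(k * (b - a))) * f a := by
  have hexp : ∀ t ∈ Icc a b, Real.exp (k * t)
      = Real.exp (k * a) + ∫ r in a..t, k * Real.exp (k * r) := by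
    intro t _
    rw [intervalIntegral.integral_eq_sub_of_hasDerivAt (f := fun r => Real.exp (k * r))]
    · ring
    · intro x _
      have := ((hasDerivAt_id x).const_mul k).exp
      simpa [mul_comm] using this
    · exact (by fun_prop : Continuous fun r => k * Real.exp (k * r)).intervalIntegrable _ _
  -- Integrating factor: the product of `f` with `exp (k t)` has a nonpositive derivative.
  have h := mul_sub_mul_eq_integral_of_primitive hab hp
    ((by fun_prop : Continuous fun r => k * Real.exp (k * r)).intervalIntegrable _ _) hf hexp
  have h0 : ∫ r in a..b, p r * Real.exp (k * r) + f r * (k * Real.exp (k * r)) ≤ 0 := by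
    rw [intervalIntegral.integral_of_le hab]
    apply integral_nonpos_of_ae
    filter_upwards [hle] with r hr
    have := mul_le_mul_of_nonneg_right hr (Real.exp_pos (k * r)).le
    simp only [Pi.zero_apply]
    linarith
  have h1 : f b * Real.exp (k * b) ≤ f a * Real.exp (k * a) := by linarith
  have h2 : Real.exp (-(k * (b - a))) = Real.exp (k * a) / Real.exp (k * b) := by
    rw [← Real.exp_sub]; congr 1; ring
  rw [h2, div_mul_eq_mul_div, le_div_iff₀ (Real.exp_pos _)]
  linarith

/-! ### Representation, measurability and Parseval sums in Hilbert spaces. -/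

section Hilbert

variable {F : Type*} [NormedAddCommGroup F] [InnerProductSpace ℝ F]

/-- **Lions' representation theorem.** A linear functional `L` on a space of test functions is
of the form `φ ↦ (u, K φ)` as soon as it is bounded by `‖K φ‖`. -/
theorem exists_inner_eq_of_abs_le [CompleteSpace F] {Φ : Type*} [AddCommGroup Φ] [Module ℝ Φ]
    (K : Φ →ₗ[ℝ] F) (L : Φ →ₗ[ℝ] ℝ) (c : ℝ) (h : ∀ φ, |L φ| ≤ c * ‖K φ‖) :
    ∃ u : F, ∀ φ, inner ℝ u (K φ) = L φ := by
  obtain ⟨G, hG⟩ := K.rangeRestrict.exists_rightInverse_of_surjective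
    (LinearMap.range_eq_top.2 K.surjective_rangeRestrict)
  have hG' : ∀ x, K (G x) = x := fun x => congrArg Subtype.val (LinearMap.congr_fun hG x)
  have hb : ∀ x, ‖(L ∘ₗ G) x‖ ≤ c * ‖x‖ := fun x => by
    have := h (G x)
    rwa [hG'] at this
  obtain ⟨g, hg, -⟩ := exists_extension_norm_eq (LinearMap.range K) ((L ∘ₗ G).mkContinuous c hb)
  refine ⟨(InnerProductSpace.toDual ℝ F).symm g, fun φ => ?_⟩
  rw [InnerProductSpace.toDual_symm_apply]
  refine (hg (K.rangeRestrict φ)).trans ?_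
  change L (G (K.rangeRestrict φ)) = L φ
  -- The bound makes `L` vanish on the kernel of `K`, so the choice of preimage by `G` does not
  -- matter.
  have h1 := h (G (K.rangeRestrict φ) - φ)
  rw [map_sub, map_sub, hG', show (K.rangeRestrict φ : F) = K φ from rfl, sub_self, norm_zero,
    mul_zero] at h1
  exact sub_eq_zero.1 (abs_nonpos_iff.1 h1)

variable {ι : Type*}

/-- Distinct basis vectors are at distance `√2`, so the balls of radius `1/2` around them are
disjoint open sets. -/
theorem HilbertBasis.countable_of_separableSpace [TopologicalSpace.SeparableSpace F]
    (e : HilbertBasis ι ℝ F) : Countable ι := by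
  refine Pairwise.countable_of_isOpen_disjoint (s := fun i => Metric.ball (e i) (1 / 2)) ?_
    (fun _ => Metric.isOpen_ball) fun i => ⟨e i, Metric.mem_ball_self (by norm_num)⟩
  intro i k hik
  apply Metric.ball_disjoint_ball
  have h : ‖e i - e k‖ ^ 2 = 2 := by
    rw [norm_sub_sq_real, e.orthonormal.1, e.orthonormal.1, e.orthonormal.2 hik]
    norm_num
  rw [dist_eq_norm]
  nlinarith [norm_nonneg (e i - e k)]

/-- A form of Pettis' theorem: weakly measurable functions into a Hilbert space with a countable
basis are strongly measurable. -/
theorem HilbertBasis.aestronglyMeasurable [Countable ι] (e : HilbertBasis ι ℝ F)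
    {α : Type*} [MeasurableSpace α] {m : Measure α} {f : α → F}
    (hf : ∀ x, AEMeasurable (fun t => inner ℝ (f t) x) m) : AEStronglyMeasurable f m := by
  refine aestronglyMeasurable_of_tendsto_ae (atTop : Filter (Finset ι))
    (f := fun s t => ∑ i ∈ s, inner ℝ (f t) (e i) • e i) (fun s => ?_) (.of_forall fun t => ?_)
  · refine Finset.aestronglyMeasurable_fun_sum _ fun i _ => ?_
    exact (hf (e i)).aestronglyMeasurable.smul_const _
  · have := e.hasSum_repr (f t)
    simp only [e.repr_apply_apply, real_inner_comm] at this
    exact this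

theorem HilbertBasis.hasSum_inner_sq (e : HilbertBasis ι ℝ F) (x : F) :
    HasSum (fun i => inner ℝ (e i) x ^ 2) (‖x‖ ^ 2) := by
  have := e.hasSum_inner_mul_inner x x
  rw [real_inner_self_eq_norm_sq] at this
  simpa only [real_inner_comm, sq] using this

theorem HilbertBasis.hasSum_two_mul_inner_mul_inner (e : HilbertBasis ι ℝ F) (x y : F) :
    HasSum (fun i => 2 * (inner ℝ (e i) x * inner ℝ (e i) y)) (2 * inner ℝ x y) := by
  have := (e.hasSum_inner_mul_inner x y).mul_left 2
  simpa only [real_inner_comm] using this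

theorem HilbertBasis.hasSum_inner_sq_add_inner_sq (e : HilbertBasis ι ℝ F) (x y : F) :
    HasSum (fun i => inner ℝ (e i) x ^ 2 + inner ℝ (e i) y ^ 2) (‖x‖ ^ 2 + ‖y‖ ^ 2) :=
  (e.hasSum_inner_sq x).add (e.hasSum_inner_sq y)

theorem abs_two_mul_mul_le (x y : ℝ) : |2 * (x * y)| ≤ x ^ 2 + y ^ 2 := by
  rw [abs_le]
  constructor <;> nlinarith [sq_nonneg (x + y), sq_nonneg (x - y)]

end Hilbert

/-! ### Vector-valued distributions on the half-line. -/

section Distribution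

variable {F : Type*} [NormedAddCommGroup F] [NormedSpace ℝ F]

/-- A smooth function of integral zero, with compact support in `(0, ∞)`, has a primitive
of the same kind. -/
theorem exists_primitive_of_integral_eq_zero {η : ℝ → ℝ} (hη : ContDiff ℝ ∞ η)
    (hc : HasCompactSupport η) (hs : tsupport η ⊆ Ioi 0) (h0 : ∫ t, η t = 0) :
    ∃ φ : ℝ → ℝ, ContDiff ℝ ∞ φ ∧ HasCompactSupport φ ∧ tsupport φ ⊆ Ioi 0 ∧ deriv φ = η := by
  obtain ⟨a, b, ha, hab⟩ : ∃ a b : ℝ, 0 < a ∧ tsupport η ⊆ Icc a b := by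
    rcases (tsupport η).eq_empty_or_nonempty with h | h
    · exact ⟨1, 1, one_pos, by simp [h]⟩
    · obtain ⟨a, ha⟩ := hc.isCompact.exists_isLeast h
      obtain ⟨b, hb⟩ := hc.isCompact.exists_isGreatest h
      exact ⟨a, b, hs ha.1, fun x hx => ⟨ha.2 hx, hb.2 hx⟩⟩
  have hz : ∀ t, t ∉ Icc a b → η t = 0 := fun t ht => image_eq_zero_of_notMem_tsupport
    fun h => ht (hab h)
  have hd : ∀ t, HasDerivAt (fun t => ∫ r in a..t, η r) (η t) t := fun t =>
    intervalIntegral.integral_hasDerivAt_right (hη.continuous.intervalIntegrable _ _)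
      (hη.continuous.stronglyMeasurableAtFilter _ _) hη.continuous.continuousAt
  have hderiv : deriv (fun t => ∫ r in a..t, η r) = η := funext fun t => (hd t).deriv
  have hsupp : ∀ t, t ∉ Icc a b → ∫ r in a..t, η r = 0 := by
    intro t ht
    rcases lt_or_ge t a with h | h
    · rw [intervalIntegral.integral_symm, intervalIntegral.integral_of_le h.le,
        integral_Ioc_eq_integral_Ioo, neg_eq_zero]
      exact setIntegral_eq_zero_of_forall_eq_zero fun x hx => hz x fun h' =>
        (hx.2.trans_le h'.1).false
    · have hbt : b < t := by
        by_contra hbt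
        exact ht ⟨h, not_lt.1 hbt⟩
      rw [intervalIntegral.integral_of_le h, ← integral_Icc_eq_integral_Ioc, ← h0]
      exact setIntegral_eq_integral_of_forall_compl_eq_zero fun x hx => hz x fun h' =>
        hx ⟨h'.1, h'.2.trans hbt.le⟩
  have hts : tsupport (fun t => ∫ r in a..t, η r) ⊆ Icc a b :=
    closure_minimal (fun t ht => by_contra fun h => ht (hsupp t h)) isClosed_Icc
  exact ⟨fun t => ∫ r in a..t, η r,
    contDiff_infty_iff_deriv.2 ⟨fun t => (hd t).differentiableAt, by rwa [hderiv]⟩,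
    HasCompactSupport.intro isCompact_Icc hsupp, hts.trans fun x hx => ha.trans_le hx.1, hderiv⟩

/-- The lemma of du Bois-Reymond: a continuous function whose distributional derivative on
`(0, ∞)` is zero is a constant. -/
theorem eq_of_integral_deriv_smul_eq_zero [CompleteSpace F] {w : ℝ → F} (hw : Continuous w)
    (h : ∀ φ : ℝ → ℝ, ContDiff ℝ ∞ φ → HasCompactSupport φ → tsupport φ ⊆ Ioi 0 →
      ∫ t in Ioi 0, deriv φ t • w t = 0) {t : ℝ} (ht : 0 ≤ t) : w t = w 0 := by
  -- A bump of integral one supported in `[1/2, 3/2]`. Subtracting a multiple of it from a test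
  -- function makes the integral zero; the average of `w` against it is the candidate constant.
  let χ : ContDiffBump (1 : ℝ) := ⟨1 / 4, 1 / 2, by norm_num, by norm_num⟩
  set ρ : ℝ → ℝ := χ.normed volume with hρ
  have hρs : tsupport ρ ⊆ Ioi 0 := by
    rw [hρ, χ.tsupport_normed_eq]
    intro x hx
    rw [Real.closedBall_eq_Icc] at hx
    have h1 : (1 : ℝ) - 1 / 2 ≤ x := hx.1
    exact lt_of_lt_of_le (by norm_num) h1
  have hρd : ContDiff ℝ ∞ ρ := χ.contDiff_normed
  have hρc : HasCompactSupport ρ := χ.hasCompactSupport_normed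
  have hint : ∀ η : ℝ → ℝ, ContDiff ℝ ∞ η → HasCompactSupport η →
      Integrable (fun t => η t • w t) := fun η hη hc =>
    (hη.continuous.smul hw).integrable_of_hasCompactSupport hc.smul_right
  set c : F := ∫ t, ρ t • w t with hcdef
  have key : ∀ᵐ t : ℝ, t ∈ Ioi (0 : ℝ) → w t - c = 0 := by
    refine isOpen_Ioi.ae_eq_zero_of_integral_contDiff_smul_eq_zero
      ((hw.sub continuous_const).locallyIntegrable.locallyIntegrableOn _) fun η hη hc hs => ?_
    have hηi : Integrable η := hη.continuous.integrable_of_hasCompactSupport hc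
    set k := ∫ t, η t with hk
    have hθs : tsupport (fun t => η t - k * ρ t) ⊆ Ioi 0 :=
      (tsupport_sub _ _).trans (union_subset hs ((tsupport_mul_subset_right).trans hρs))
    have hθc : HasCompactSupport (fun t => η t - k * ρ t) :=
      hc.sub (hρc.mul_left)
    obtain ⟨φ, hφ, hφc, hφs, hφd⟩ := exists_primitive_of_integral_eq_zero
      (hη.sub (contDiff_const.mul hρd)) hθc hθs (by
        rw [integral_sub hηi (χ.integrable_normed.const_mul k), integral_const_mul,
          χ.integral_normed, mul_one, sub_self])
    have h1 := h φ hφ hφc hφs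
    rw [hφd, setIntegral_eq_integral_of_forall_compl_eq_zero (fun x hx => by
      have := image_eq_zero_of_notMem_tsupport (fun h' => hx (hθs h'))
      beta_reduce at this ⊢
      rw [this, zero_smul])] at h1
    simp only [sub_smul, mul_smul] at h1
    rw [integral_sub (g := fun t => k • ρ t • w t) (hint η hη hc) ((hint ρ hρd hρc).smul k),
      integral_smul] at h1
    simp only [smul_sub]
    rw [integral_sub (hint η hη hc) (hηi.smul_const c), integral_smul_const]
    exact h1
  have hEq : EqOn w (fun _ => c) (Ici 0) := by
    refine Measure.eqOn_of_ae_eq (μ := volume) ?_ hw.continuousOn continuousOn_const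
      (by rw [interior_Ici, closure_Ioi])
    rw [restrict_Ioi_eq_restrict_Ici.symm]
    filter_upwards [ae_restrict_of_ae key, ae_restrict_mem measurableSet_Ioi] with x hx hx'
    exact sub_eq_zero.1 (hx hx')
  exact (hEq ht).trans (hEq (le_refl (0 : ℝ))).symm

end Distribution

/-! ### Diagonalisation of the compact embedding, energy identity and continuity. -/

section Gelfand

variable {E H : Type*}
  [NormedAddCommGroup E] [InnerProductSpace ℝ E]
  [NormedAddCommGroup H] [InnerProductSpace ℝ H]

/-- The range is dense and is a countable union of images of balls, each contained in a compact set.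
-/
theorem IsCompactOperator.separableSpace {ι : E →L[ℝ] H} (hc : IsCompactOperator ι)
    (hd : DenseRange ι) : TopologicalSpace.SeparableSpace H := by
  have h1 : TopologicalSpace.IsSeparable (range ι) := by
    have h2 : range ι = ⋃ n : ℕ, ι '' Metric.closedBall 0 n := by
      rw [← image_iUnion, Metric.iUnion_closedBall_nat, image_univ]
    rw [h2]
    refine TopologicalSpace.IsSeparable.iUnion fun n => ?_
    obtain ⟨K, hK, hK'⟩ := hc.image_closedBall_subset_compact (f := ι.toLinearMap) n
    exact hK.isSeparable.mono hK'
  have h3 := h1.closure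
  rw [hd.closure_range] at h3
  exact TopologicalSpace.isSeparable_univ_iff.1 h3

variable [CompleteSpace E] [CompleteSpace H]

open ContinuousLinearMap in
theorem DenseRange.adjoint_injective {ι : E →L[ℝ] H} (hd : DenseRange ι) :
    Function.Injective (adjoint ι) := by
  rw [injective_iff_map_eq_zero]
  intro h hh
  refine hd.eq_zero_of_inner_left ℝ fun v => ?_
  rw [← adjoint_inner_left, hh, inner_zero_left]

/-- A compact symmetric operator has a Hilbert basis of eigenvectors. -/
theorem exists_hilbertBasis_eigenvectors {H : Type*} [NormedAddCommGroup H] [InnerProductSpace ℝ H]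
    [CompleteSpace H] (S : H →L[ℝ] H) (hSc : IsCompactOperator S)
    (hSs : (S : H →ₗ[ℝ] H).IsSymmetric) :
    ∃ (w : (μ : ℝ) → Set (Module.End.eigenspace (S : Module.End ℝ H) μ))
      (e : HilbertBasis (Σ μ, w μ) ℝ H), ∀ i, S (e i) = i.1 • e i := by
  have hbot := S.orthogonalComplement_iSup_eigenspaces_eq_bot hSc hSs
  have hcl : ∀ μ, CompleteSpace (Module.End.eigenspace (S : Module.End ℝ H) μ) := by
    intro μ
    have : IsClosed (Module.End.eigenspace (S : Module.End ℝ H) μ : Set H) := by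
      have : (Module.End.eigenspace (S : Module.End ℝ H) μ : Set H) = {x | S x = μ • x} := by
        ext x
        simp
      rw [this]
      exact isClosed_eq S.continuous (continuous_const_smul μ)
    exact this.completeSpace_coe
  choose w B hB using fun μ =>
    _root_.exists_hilbertBasis ℝ (Module.End.eigenspace (S : Module.End ℝ H) μ)
  have hon := hSs.orthogonalFamily_eigenspaces.orthonormal_sigma_orthonormal
    fun μ => (B μ).orthonormal
  have horth : (Submodule.span ℝ (range fun a : Σ μ, w μ =>
      (Module.End.eigenspace (S : Module.End ℝ H) a.1).subtypeₗᵢ (B a.1 a.2)))ᗮ = ⊥ := by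
    rw [eq_bot_iff, ← hbot]
    intro x hx
    rw [Submodule.mem_orthogonal'] at hx ⊢
    suffices h : (⨆ μ, Module.End.eigenspace (S : Module.End ℝ H) μ)
        ≤ LinearMap.ker (innerSL ℝ x : H →ₗ[ℝ] ℝ) from fun u hu => h hu
    refine iSup_le fun μ y hy => ?_
    have h1 : (Submodule.span ℝ (range (B μ))).topologicalClosure
        ≤ LinearMap.ker (((innerSL ℝ x).comp (Submodule.subtypeL
          (Module.End.eigenspace (S : Module.End ℝ H) μ)) : _ →L[ℝ] ℝ) : _ →ₗ[ℝ] ℝ) := by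
      refine Submodule.topologicalClosure_minimal _ ?_ (ContinuousLinearMap.isClosed_ker _)
      rw [Submodule.span_le]
      rintro _ ⟨i, rfl⟩
      exact hx _ (Submodule.subset_span ⟨⟨μ, i⟩, rfl⟩)
    rw [(B μ).dense_span] at h1
    exact h1 (show (⟨y, hy⟩ : Module.End.eigenspace (S : Module.End ℝ H) μ) ∈ ⊤ from trivial)
  refine ⟨w, HilbertBasis.mkOfOrthogonalEqBot hon horth, fun i => ?_⟩
  rw [HilbertBasis.coe_mkOfOrthogonalEqBot]
  exact Module.End.mem_eigenspace_iff.1 (B i.1 i.2).2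

open ContinuousLinearMap in
/-- Orthonormal bases `e` of `H` and `b` of `E`, that diagonalise the compact injective dense
map `ι : E → H`. -/
theorem IsCompactOperator.exists_hilbertBasis.{u, v} {E : Type u} {H : Type v}
    [NormedAddCommGroup E] [InnerProductSpace ℝ E] [CompleteSpace E]
    [NormedAddCommGroup H] [InnerProductSpace ℝ H] [CompleteSpace H]
    {ι : E →L[ℝ] H} (hc : IsCompactOperator ι) (hd : DenseRange ι) (hi : Function.Injective ι) :
    ∃ (I : Type v) (_ : Countable I) (e : HilbertBasis I ℝ H) (b : HilbertBasis I ℝ E) (s : I → ℝ),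
      (∀ i, 0 < s i) ∧ ∀ i, adjoint ι (e i) = s i • b i := by
  have : TopologicalSpace.SeparableSpace H := hc.separableSpace hd
  -- Singular value decomposition: the eigenvectors of `ι ι*` form `e`, and the normalised `ι* eᵢ`
  -- form `b`. Density of the range makes `ι*` injective, hence `sᵢ = ‖ι* eᵢ‖ > 0`; injectivity of
  -- `ι` makes `b` total.
  set S : H →L[ℝ] H := ι ∘L adjoint ι with hS
  have hSc : IsCompactOperator S := hc.comp_clm (adjoint ι)
  have hSs : (S : H →ₗ[ℝ] H).IsSymmetric := by
    intro x y
    change inner ℝ (ι (adjoint ι x)) y = inner ℝ x (ι (adjoint ι y))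
    rw [← adjoint_inner_right, adjoint_inner_left]
  obtain ⟨w, e, he⟩ := exists_hilbertBasis_eigenvectors S hSc hSs
  have hpos : ∀ i, 0 < ‖adjoint ι (e i)‖ := fun i => norm_pos_iff.2 fun h =>
    e.orthonormal.ne_zero i (hd.adjoint_injective (h.trans (map_zero _).symm))
  have hin : ∀ i k, inner ℝ (adjoint ι (e i)) (adjoint ι (e k)) = i.1 * inner ℝ (e i) (e k) := by
    intro i k
    rw [adjoint_inner_right, ← real_inner_smul_left, ← he]
    rfl
  have hob : Orthonormal ℝ fun i => ‖adjoint ι (e i)‖⁻¹ • adjoint ι (e i) := by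
    refine ⟨fun i => ?_, fun i k hik => ?_⟩
    · rw [norm_smul, norm_inv, norm_norm, inv_mul_cancel₀ (hpos i).ne']
    · beta_reduce
      rw [real_inner_smul_left, real_inner_smul_right, hin, e.orthonormal.2 hik]
      simp
  have horth' : (Submodule.span ℝ (range fun i => ‖adjoint ι (e i)‖⁻¹ • adjoint ι (e i)))ᗮ = ⊥ := by
    rw [eq_bot_iff]
    intro v hv
    rw [Submodule.mem_orthogonal'] at hv
    refine hi (?_ : ι v = ι 0)
    rw [map_zero]
    have hz : ∀ i, inner ℝ (e i) (ι v) = 0 := by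
      intro i
      have := hv _ (Submodule.subset_span ⟨i, rfl⟩)
      rw [real_inner_smul_right, adjoint_inner_right] at this
      rw [real_inner_comm]
      exact (mul_eq_zero.1 this).resolve_left (inv_ne_zero (hpos i).ne')
    have h2 := e.hasSum_inner_sq (ι v)
    simp only [hz, zero_pow (two_ne_zero)] at h2
    exact norm_eq_zero.1 (pow_eq_zero_iff two_ne_zero |>.1 (h2.unique hasSum_zero))
  refine ⟨_, e.countable_of_separableSpace, e,
    HilbertBasis.mkOfOrthogonalEqBot hob horth', fun i => ‖adjoint ι (e i)‖, hpos, fun i => ?_⟩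
  rw [HilbertBasis.coe_mkOfOrthogonalEqBot]
  rw [smul_smul, mul_inv_cancel₀ (hpos i).ne', one_smul]

section Basis

open ContinuousLinearMap

variable {ι : E →L[ℝ] H} {I : Type*} {e : HilbertBasis I ℝ H} {b : HilbertBasis I ℝ E}
  {s : I → ℝ}

theorem inner_basis_apply (hj : ∀ i, adjoint ι (e i) = s i • b i) (i : I) (z : E) :
    inner ℝ (e i) (ι z) = s i * inner ℝ (b i) z := by
  rw [← adjoint_inner_left, hj, real_inner_smul_left]

theorem inner_basis_adjoint (hj : ∀ i, adjoint ι (e i) = s i • b i) (i : I) (u : H) :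
    inner ℝ (b i) (adjoint ι u) = s i * inner ℝ (e i) u := by
  classical
  have h : ι (b i) = s i • e i := by
    refine e.repr.injective (lp.ext (funext fun k => ?_))
    rw [map_smul, lp.coeFn_smul, Pi.smul_apply, e.repr_apply_apply, e.repr_apply_apply,
      inner_basis_apply hj, orthonormal_iff_ite.1 e.orthonormal, orthonormal_iff_ite.1 b.orthonormal]
    by_cases hki : k = i <;> simp [hki]
  rw [adjoint_inner_right, h, real_inner_smul_left]

/-- Coordinates of a trajectory are primitives. -/
theorem coordinate_eq_add_integral (hs : ∀ i, 0 < s i) (hj : ∀ i, adjoint ι (e i) = s i • b i)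
    {z : ℝ → E} {g : ℝ → H} {a t : ℝ} (hg : IntervalIntegrable g volume a t)
    (hz : ι (z t) = ι (z a) + ∫ r in a..t, g r) (i : I) :
    inner ℝ (b i) (z t) = inner ℝ (b i) (z a) + ∫ r in a..t, (s i)⁻¹ * inner ℝ (e i) (g r) := by
  have h1 := congrArg (inner ℝ (e i)) hz
  rw [inner_add_right, inner_basis_apply hj, inner_basis_apply hj] at h1
  have h2 : inner ℝ (e i) (∫ r in a..t, g r) = ∫ r in a..t, inner ℝ (e i) (g r) :=
    ((innerSL ℝ (e i)).intervalIntegral_comp_comm hg).symm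
  rw [intervalIntegral.integral_const_mul, ← h2]
  have := (hs i).ne'
  field_simp
  linarith

/-- Coordinate version of the energy identity. -/
theorem coordinate_sq_sub_sq (hs : ∀ i, 0 < s i) (hj : ∀ i, adjoint ι (e i) = s i • b i)
    {z : ℝ → E} {u g : ℝ → H} {a c : ℝ} (hac : a ≤ c) (hg : IntervalIntegrable g volume a c)
    (hz : ∀ t ∈ Icc a c, ι (z t) = ι (z a) + ∫ r in a..t, g r)
    (hu : ∀ᵐ t ∂(volume.restrict (Ioc a c)), z t = adjoint ι (u t)) (i : I) :
    inner ℝ (b i) (z c) ^ 2 - inner ℝ (b i) (z a) ^ 2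
      = ∫ r in a..c, 2 * (inner ℝ (e i) (u r) * inner ℝ (e i) (g r)) := by
  have hgi : IntervalIntegrable (fun r => inner ℝ (e i) (g r)) volume a c := by
    rw [intervalIntegrable_iff] at hg ⊢
    exact hg.const_inner (e i)
  have hp : ∀ t ∈ Icc a c, inner ℝ (b i) (z t)
      = inner ℝ (b i) (z a) + ∫ r in a..t, (s i)⁻¹ * inner ℝ (e i) (g r) := fun t ht =>
    coordinate_eq_add_integral hs hj
      (hg.mono_set (by rw [uIcc_of_le hac, uIcc_of_le ht.1]; exact Icc_subset_Icc_right ht.2))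
      (hz t ht) i
  refine sq_sub_sq_eq_integral_of_primitive (f := fun t => inner ℝ (b i) (z t)) (hs i) hac hgi hp ?_
  filter_upwards [hu] with t ht
  rw [ht, inner_basis_adjoint hj]

/-- The energy identity of Lions and Magenes. -/
theorem norm_sq_sub_norm_sq_eq_integral [Countable I]
    (hs : ∀ i, 0 < s i) (hj : ∀ i, adjoint ι (e i) = s i • b i)
    {z : ℝ → E} {u g : ℝ → H} {a c : ℝ} (hac : a ≤ c)
    (hu2 : MemLp u 2 (volume.restrict (Ioc a c))) (hg2 : MemLp g 2 (volume.restrict (Ioc a c)))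
    (hz : ∀ t ∈ Icc a c, ι (z t) = ι (z a) + ∫ r in a..t, g r)
    (hu : ∀ᵐ t ∂(volume.restrict (Ioc a c)), z t = adjoint ι (u t)) :
    ‖z c‖ ^ 2 - ‖z a‖ ^ 2 = ∫ r in a..c, 2 * inner ℝ (u r) (g r) := by
  have hg : IntervalIntegrable g volume a c :=
    (intervalIntegrable_iff_integrableOn_Ioc_of_le hac).2 (hg2.integrable (by norm_num))
  have h1 : HasSum (fun i => inner ℝ (b i) (z c) ^ 2 - inner ℝ (b i) (z a) ^ 2)
      (‖z c‖ ^ 2 - ‖z a‖ ^ 2) := (b.hasSum_inner_sq _).sub (b.hasSum_inner_sq _)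
  refine h1.unique ?_
  simp only [coordinate_sq_sub_sq hs hj hac hg hz hu, intervalIntegral.integral_of_le hac]
  -- The coordinate identities carry no weight `sᵢ`, so they sum under the integral, dominated by
  -- `‖u‖² + ‖g‖²`.
  refine hasSum_integral_of_dominated_convergence
    (fun i r => inner ℝ (e i) (u r) ^ 2 + inner ℝ (e i) (g r) ^ 2) (fun i => ?_)
    (fun i => .of_forall fun r => abs_two_mul_mul_le _ _)
    (.of_forall fun r => (e.hasSum_inner_sq_add_inner_sq _ _).summable) ?_
    (.of_forall fun r => e.hasSum_two_mul_inner_mul_inner _ _)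
  · exact ((hu2.1.const_inner (c := e i)).mul (hg2.1.const_inner (c := e i))).const_mul 2
  · simp only [(e.hasSum_inner_sq_add_inner_sq _ _).tsum_eq]
    exact hu2.integrable_norm_pow'.add hg2.integrable_norm_pow'

/-- A function of `L²(0, ∞; D(A)) ∩ H¹(0, ∞; H)` is continuous with values in the
intermediate space `E`. -/
theorem exists_continuous_representative [Countable I]
    (hs : ∀ i, 0 < s i) (hj : ∀ i, adjoint ι (e i) = s i • b i) (z₀ : E) {u g : ℝ → H}
    (hu2 : MemLp u 2 (volume.restrict (Ioi 0))) (hg2 : MemLp g 2 (volume.restrict (Ioi 0)))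
    (h : ∀ᵐ t ∂(volume.restrict (Ioi (0 : ℝ))),
      ι (adjoint ι (u t)) = ι z₀ + ∫ r in (0 : ℝ)..t, g r) :
    ∃ z : ℝ → E, Continuous z ∧ z 0 = z₀ ∧
      ∀ t, 0 ≤ t → ι (z t) = ι z₀ + ∫ r in (0 : ℝ)..t, g r := by
  have hgi : ∀ τ, IntegrableOn g (Ioc 0 τ) := fun τ =>
    (hg2.mono_measure (Measure.restrict_mono Ioc_subset_Ioi_self le_rfl)).integrable (by norm_num)
  have hgI : ∀ {τ}, 0 ≤ τ → IntervalIntegrable g volume 0 τ := fun hτ =>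
    (intervalIntegrable_iff_integrableOn_Ioc_of_le hτ).2 (hgi _)
  -- The only possible coordinates of `z(t)`, obtained by dividing those of `ι z(t)` by `sᵢ`. That
  -- they are square summable is the point of the proof.
  set c : I → ℝ → ℝ := fun i t => (s i)⁻¹ * inner ℝ (e i) (ι z₀ + ∫ r in (0 : ℝ)..max t 0, g r)
    with hc
  have hcc : ∀ i, Continuous (c i) := fun i =>
    continuous_const.mul (continuous_const.inner
      (continuous_const.add (continuous_integral_max_zero fun τ _ => hgi τ)))
  have hc0 : ∀ i, c i 0 = inner ℝ (b i) z₀ := by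
    intro i
    have := (hs i).ne'
    simp only [hc, max_self, intervalIntegral.integral_same, add_zero, inner_basis_apply hj]
    field_simp
  have hprim : ∀ i t, 0 ≤ t → c i t = c i 0 + ∫ r in (0 : ℝ)..t, (s i)⁻¹ * inner ℝ (e i) (g r) := by
    intro i t ht
    simp only [hc, max_self, intervalIntegral.integral_same, add_zero, max_eq_left ht]
    rw [intervalIntegral.integral_const_mul, inner_add_right, mul_add]
    congr 2
    exact ((innerSL ℝ (e i)).intervalIntegral_comp_comm (hgI ht)).symm
  have hgiI : ∀ i t, 0 ≤ t → IntervalIntegrable (fun r => inner ℝ (e i) (g r)) volume 0 t := by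
    intro i t ht
    exact (intervalIntegrable_iff_integrableOn_Ioc_of_le ht).2 ((hgi t).const_inner (e i))
  have hcu : ∀ i, ∀ᵐ t ∂(volume.restrict (Ioi (0 : ℝ))), c i t = s i * inner ℝ (e i) (u t) := by
    intro i
    filter_upwards [h, ae_restrict_mem measurableSet_Ioi] with t ht ht0
    simp only [hc, max_eq_left (le_of_lt (mem_Ioi.1 ht0))]
    have := (hs i).ne'
    rw [← ht, inner_basis_apply hj, inner_basis_adjoint hj]
    field_simp
  have hint : ∀ i, Integrable (fun r => inner ℝ (e i) (u r) ^ 2 + inner ℝ (e i) (g r) ^ 2)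
      (volume.restrict (Ioi 0)) := fun i =>
    (hu2.const_inner (e i)).integrable_sq.add (hg2.const_inner (e i)).integrable_sq
  -- A summable bound for `cᵢ(t)²`, uniform in `t`. It gives membership in `ℓ²` and, by dominated
  -- convergence, continuity in the norm of `E`.
  set B : I → ℝ := fun i => inner ℝ (b i) z₀ ^ 2
    + ∫ r in Ioi 0, (inner ℝ (e i) (u r) ^ 2 + inner ℝ (e i) (g r) ^ 2) with hB
  have hBs : Summable B := by
    refine (b.hasSum_inner_sq z₀).summable.add (HasSum.summable
      (hasSum_integral_of_dominated_convergence
        (f := fun r => ‖u r‖ ^ 2 + ‖g r‖ ^ 2)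
        (fun i r => inner ℝ (e i) (u r) ^ 2 + inner ℝ (e i) (g r) ^ 2)
        (fun i => (hint i).aestronglyMeasurable)
        (fun i => .of_forall fun r => by rw [Real.norm_of_nonneg (by positivity)])
        (.of_forall fun r => (e.hasSum_inner_sq_add_inner_sq _ _).summable) ?_
        (.of_forall fun r => e.hasSum_inner_sq_add_inner_sq _ _)))
    simp only [(e.hasSum_inner_sq_add_inner_sq _ _).tsum_eq]
    exact hu2.norm.integrable_sq.add hg2.norm.integrable_sq
  have hle : ∀ i t, c i t ^ 2 ≤ B i := by
    intro i t
    have hmax : c i t = c i (max t 0) := by simp only [hc, max_assoc, max_self]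
    rw [hmax]
    have ht : 0 ≤ max t 0 := le_max_right _ _
    generalize max t 0 = t at ht
    have h1 := sq_sub_sq_eq_integral_of_primitive (f := c i) (hs i) ht (hgiI i t ht)
      (fun r hr => hprim i r hr.1)
      (ae_restrict_of_ae_restrict_of_subset Ioc_subset_Ioi_self (hcu i))
    have h2 : ∫ r in (0 : ℝ)..t, 2 * (inner ℝ (e i) (u r) * inner ℝ (e i) (g r))
        ≤ ∫ r in Ioi 0, (inner ℝ (e i) (u r) ^ 2 + inner ℝ (e i) (g r) ^ 2) := by
      rw [intervalIntegral.integral_of_le ht]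
      refine ((Real.le_norm_self _).trans (norm_integral_le_of_norm_le
        (g := fun r => inner ℝ (e i) (u r) ^ 2 + inner ℝ (e i) (g r) ^ 2)
        ((hint i).mono_measure (Measure.restrict_mono Ioc_subset_Ioi_self le_rfl))
        (.of_forall fun r => (Real.norm_eq_abs _).trans_le (abs_two_mul_mul_le _ _)))).trans ?_
      exact setIntegral_mono_set (hint i) (.of_forall fun r => by
        simp only [Pi.zero_apply]; positivity)
        (show Ioc 0 t ⊆ Ioi 0 from Ioc_subset_Ioi_self).eventuallyLE
    rw [hc0] at h1
    simp only [hB]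
    linarith
  have hmem : ∀ t, Memℓp (fun i => c i t) 2 := by
    intro t
    refine memℓp_gen (hBs.of_nonneg_of_le (fun i => by positivity) fun i => ?_)
    have := hle i t
    simpa using this
  set z : ℝ → E := fun t => b.repr.symm ⟨fun i => c i t, hmem t⟩ with hz
  have hbz : ∀ i t, inner ℝ (b i) (z t) = c i t := by
    intro i t
    rw [← b.repr_apply_apply, hz, LinearIsometryEquiv.apply_symm_apply]
  refine ⟨z, ?_, ?_, fun t ht => ?_⟩
  · rw [continuous_iff_continuousAt]
    intro t
    rw [ContinuousAt, tendsto_iff_norm_sub_tendsto_zero]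
    have h1 : ∀ r, HasSum (fun i => (c i r - c i t) ^ 2) (‖z r - z t‖ ^ 2) := by
      intro r
      have := b.hasSum_inner_sq (z r - z t)
      simpa only [inner_sub_right, hbz] using this
    have h2 : Tendsto (fun r => ∑' i, (c i r - c i t) ^ 2) (𝓝 t) (𝓝 (∑' _ : I, (0 : ℝ))) := by
      refine tendsto_tsum_of_dominated_convergence (bound := fun i => 4 * B i) (hBs.mul_left 4)
        (fun i => ?_) (.of_forall fun r i => ?_)
      · have := (((hcc i).sub (continuous_const (y := c i t))).pow 2).tendsto t
        simpa [Pi.pow_def, Pi.sub_def] using this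
      · rw [Real.norm_of_nonneg (by positivity)]
        nlinarith [hle i r, hle i t, sq_nonneg (c i r + c i t)]
    simp only [(h1 _).tsum_eq, tsum_zero] at h2
    have h3 := (Real.continuous_sqrt.tendsto 0).comp h2
    simpa [Function.comp_def, Real.sqrt_sq (norm_nonneg _)] using h3
  · refine b.repr.injective (lp.ext (funext fun i => ?_))
    rw [b.repr_apply_apply, b.repr_apply_apply, hbz, hc0]
  · refine e.repr.injective (lp.ext (funext fun i => ?_))
    rw [e.repr_apply_apply, e.repr_apply_apply, inner_basis_apply hj, hbz]
    have := (hs i).ne'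
    simp only [hc, max_eq_left ht]
    field_simp

end Basis

end Gelfand

/-! ### Existence by Lions' method on the whole half-line. -/

section Existence

open ContinuousLinearMap

variable {H : Type*} [NormedAddCommGroup H] [InnerProductSpace ℝ H]

/-- `C¹` functions on `ℝ` that vanish for large times. -/
def testFunctions (H : Type*) [NormedAddCommGroup H] [InnerProductSpace ℝ H] :
    Submodule ℝ (ℝ → H) where
  carrier := {φ | ContDiff ℝ 1 φ ∧ ∃ T : ℝ, ∀ t, T ≤ t → φ t = 0}
  zero_mem' := ⟨contDiff_const, 0, fun _ _ => rfl⟩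
  add_mem' := by
    rintro φ ψ ⟨h1, T1, h2⟩ ⟨h3, T3, h4⟩
    refine ⟨h1.add h3, max T1 T3, fun t ht => ?_⟩
    rw [Pi.add_apply, h2 t ((le_max_left _ _).trans ht), h4 t ((le_max_right _ _).trans ht),
      add_zero]
  smul_mem' := by
    rintro c φ ⟨h1, T1, h2⟩
    exact ⟨h1.const_smul c, T1, fun t ht => by rw [Pi.smul_apply, h2 t ht, smul_zero]⟩

theorem MeasureTheory.MemLp.integrable_inner {α : Type*} [MeasurableSpace α] {m : Measure α}
    {f g : α → H} (hf : MemLp f 2 m) (hg : MemLp g 2 m) :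
    Integrable (fun t => inner ℝ (f t) (g t)) m := by
  refine (L2.integrable_inner (𝕜 := ℝ) (hf.toLp f) (hg.toLp g)).congr ?_
  filter_upwards [hf.coeFn_toLp, hg.coeFn_toLp] with t h1 h2
  rw [h1, h2]

theorem Continuous.memLp_Ioi_of_forall_le_eq_zero {H : Type*} [NormedAddCommGroup H]
    {f : ℝ → H} (hf : Continuous f) {T : ℝ}
    (hT : ∀ t, T ≤ t → f t = 0) : MemLp f 2 (volume.restrict (Ioi 0)) := by
  have h1 : (Iic T).indicator f = f := by
    rw [indicator_eq_self]
    intro t ht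
    by_contra h
    exact ht (hT t (not_le.1 h).le)
  rw [← h1, memLp_indicator_iff_restrict measurableSet_Iic,
    Measure.restrict_restrict measurableSet_Iic]
  have h2 : Iic T ∩ Ioi 0 ⊆ Icc 0 T := fun x hx => ⟨le_of_lt hx.2, hx.1⟩
  refine MemLp.mono_measure (Measure.restrict_mono h2 le_rfl) ?_
  obtain ⟨C, hC⟩ := isCompact_Icc.exists_bound_of_continuousOn (hf.continuousOn (s := Icc 0 T))
  exact MemLp.of_bound hf.aestronglyMeasurable C
    ((ae_restrict_iff' measurableSet_Icc).2 (.of_forall hC))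

theorem testFunctions.memLp {φ : ℝ → H} (hφ : φ ∈ testFunctions H) :
    MemLp φ 2 (volume.restrict (Ioi 0)) := by
  obtain ⟨h, T, hT⟩ := hφ
  exact h.continuous.memLp_Ioi_of_forall_le_eq_zero hT

theorem testFunctions.differentiable {φ : ℝ → H} (hφ : φ ∈ testFunctions H) :
    Differentiable ℝ φ := hφ.1.differentiable one_ne_zero

theorem testFunctions.memLp_deriv {φ : ℝ → H} (hφ : φ ∈ testFunctions H) :
    MemLp (deriv φ) 2 (volume.restrict (Ioi 0)) := by
  obtain ⟨h, T, hT⟩ := hφ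
  -- With `T + 1` in place of `T`, the function vanishes in a neighbourhood of each `t` considered.
  refine (h.continuous_deriv le_rfl).memLp_Ioi_of_forall_le_eq_zero (T := T + 1) fun t ht => ?_
  have : φ =ᶠ[𝓝 t] fun _ => 0 := by
    filter_upwards [Ioi_mem_nhds (show T < t by linarith)] with r hr using hT r (le_of_lt hr)
  rw [this.deriv_eq, deriv_const]

variable [CompleteSpace H] {I : Type*} [Countable I] {α : Type*} [MeasurableSpace α]
  {m : Measure α}

theorem HilbertBasis.aestronglyMeasurable_adjoint_apply (e : HilbertBasis I ℝ H)
    {N : α → H →L[ℝ] H} (hN : ∀ h k, AEMeasurable (fun t => inner ℝ (N t h) k) m) (k : H) :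
    AEStronglyMeasurable (fun t => adjoint (N t) k) m :=
  e.aestronglyMeasurable fun h => by
    simpa only [adjoint_inner_left, real_inner_comm] using hN h k

/-- Weak measurability suffices: in `(N(t) u(t), k) = (u(t), N(t)* k)` both factors on the right are
strongly measurable, the second because `k` is fixed. -/
theorem HilbertBasis.aestronglyMeasurable_clm_apply (e : HilbertBasis I ℝ H)
    {N : α → H →L[ℝ] H} (hN : ∀ h k, AEMeasurable (fun t => inner ℝ (N t h) k) m)
    {u : α → H} (hu : AEStronglyMeasurable u m) : AEStronglyMeasurable (fun t => N t (u t)) m :=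
  e.aestronglyMeasurable fun k => by
    have := (hu.inner (𝕜 := ℝ) (e.aestronglyMeasurable_adjoint_apply hN k)).aemeasurable
    simpa only [adjoint_inner_right] using this

theorem HilbertBasis.memLp_clm_apply (e : HilbertBasis I ℝ H)
    {N : α → H →L[ℝ] H} (hN : ∀ h k, AEMeasurable (fun t => inner ℝ (N t h) k) m)
    {K : ℝ} (hK : ∀ᵐ t ∂m, ‖N t‖ ≤ K) {u : α → H} (hu : MemLp u 2 m) :
    MemLp (fun t => N t (u t)) 2 m := by
  refine MemLp.of_le_mul hu (e.aestronglyMeasurable_clm_apply hN hu.1) (c := K) ?_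
  filter_upwards [hK] with t ht
  exact (N t).le_of_opNorm_le ht _

theorem HilbertBasis.memLp_adjoint_apply (e : HilbertBasis I ℝ H)
    {N : α → H →L[ℝ] H} (hN : ∀ h k, AEMeasurable (fun t => inner ℝ (N t h) k) m)
    {K : ℝ} (hK : ∀ᵐ t ∂m, ‖N t‖ ≤ K) {u : α → H} (hu : MemLp u 2 m) :
    MemLp (fun t => adjoint (N t) (u t)) 2 m := by
  refine e.memLp_clm_apply (fun h k => ?_) (K := K) ?_ hu
  · simpa only [adjoint_inner_left, real_inner_comm] using hN k h
  · simpa only [LinearIsometryEquiv.norm_map] using hK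

variable {E : Type*} [NormedAddCommGroup E] [InnerProductSpace ℝ E] [CompleteSpace E]

/-- The integrand is the derivative of `-½‖j φ‖²`. Test functions need not vanish at `0`, and this
boundary term is what controls the initial datum in Lions' method. -/
theorem integral_inner_deriv_eq {H E : Type*} [NormedAddCommGroup H] [InnerProductSpace ℝ H]
    [NormedAddCommGroup E] [InnerProductSpace ℝ E] (j : H →L[ℝ] E) {φ : ℝ → H}
    (hφ : φ ∈ testFunctions H) :
    ∫ t in Ioi 0, -inner ℝ (j (φ t)) (j (deriv φ t)) = 1 / 2 * ‖j (φ 0)‖ ^ 2 := by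
  have hd : ∀ t, HasDerivAt (fun t => -(1 / 2 * ‖j (φ t)‖ ^ 2))
      (-inner ℝ (j (φ t)) (j (deriv φ t))) t := by
    intro t
    have h1 : HasDerivAt (fun t => j (φ t)) (j (deriv φ t)) t :=
      j.hasFDerivAt.comp_hasDerivAt t (testFunctions.differentiable hφ t).hasDerivAt
    convert! (h1.norm_sq.const_mul (1 / 2 : ℝ)).neg using 1
    ring
  obtain ⟨-, T, hT⟩ := id hφ
  have hlim : Tendsto (fun t => -(1 / 2 * ‖j (φ t)‖ ^ 2)) atTop (𝓝 0) := by
    refine tendsto_const_nhds.congr' ?_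
    filter_upwards [eventually_ge_atTop T] with t ht
    rw [hT t ht]
    simp
  rw [integral_Ioi_of_hasDerivAt_of_tendsto' (fun t _ => hd t) ?_ hlim]
  · ring
  · have h1 := j.comp_memLp' (testFunctions.memLp hφ)
    have h2 := j.comp_memLp' (testFunctions.memLp_deriv hφ)
    exact (h1.integrable_inner h2).neg

/-- The existence part of Lions' theorem, for the equation `(ι z)' + N(t) A z = 0`, `z(0) = z₀`
with a coercive `N`; the unknown is `u = A z`, that is `z = ι* u`. -/
theorem exists_memLp_primitive_eq (e : HilbertBasis I ℝ H) (ι : E →L[ℝ] H) {N : ℝ → H →L[ℝ] H}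
    (hN : ∀ h k, AEMeasurable (fun t => inner ℝ (N t h) k) (volume.restrict (Ioi 0)))
    {K α : ℝ} (hK : ∀ᵐ t ∂(volume.restrict (Ioi (0 : ℝ))), ‖N t‖ ≤ K) (hα : 0 < α)
    (hc : ∀ᵐ t ∂(volume.restrict (Ioi (0 : ℝ))), ∀ h, α * ‖h‖ ^ 2 ≤ inner ℝ (N t h) h) (z₀ : E) :
    ∃ u : ℝ → H, MemLp u 2 (volume.restrict (Ioi 0)) ∧
      ∀ φ ∈ testFunctions H,
        ∫ t in Ioi 0, (-inner ℝ (ι (adjoint ι (u t))) (deriv φ t) + inner ℝ (N t (u t)) (φ t))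
          = inner ℝ (ι z₀) (φ 0) := by
  have hmem : ∀ φ : testFunctions H, MemLp (fun t => -(ι (adjoint ι (deriv φ.1 t)))
      + adjoint (N t) (φ.1 t)) 2 (volume.restrict (Ioi 0)) := fun φ =>
    ((ι ∘L adjoint ι).comp_memLp' (testFunctions.memLp_deriv φ.2)).neg.add
      (e.memLp_adjoint_apply hN hK (testFunctions.memLp φ.2))
  -- The formal adjoint of the equation, `φ ↦ -ι ι* φ' + N* φ`; the functional `L` encodes the
  -- initial condition.
  let Kf : testFunctions H →ₗ[ℝ] Lp H 2 (volume.restrict (Ioi (0 : ℝ))) :=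
    { toFun := fun φ => (hmem φ).toLp _
      map_add' := fun φ ψ => by
        rw [← MemLp.toLp_add]
        refine MemLp.toLp_congr _ _ (.of_forall fun t => ?_)
        simp only [Submodule.coe_add, Pi.add_apply]
        rw [deriv_add (testFunctions.differentiable φ.2 t) (testFunctions.differentiable ψ.2 t)]
        simp only [map_add]
        abel
      map_smul' := fun c φ => by
        rw [RingHom.id_apply, ← MemLp.toLp_const_smul]
        refine MemLp.toLp_congr _ _ (.of_forall fun t => ?_)
        simp only [Submodule.coe_smul, Pi.smul_apply]
        rw [deriv_const_smul c (testFunctions.differentiable φ.2 t)]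
        simp only [map_smul, smul_add, smul_neg] }
  let L : testFunctions H →ₗ[ℝ] ℝ :=
    { toFun := fun φ => inner ℝ (ι z₀) (φ.1 0)
      map_add' := fun φ ψ => by simp [inner_add_right]
      map_smul' := fun c φ => by simp [real_inner_smul_right] }
  have hbound : ∀ φ, |L φ| ≤ ‖z₀‖ * Real.sqrt (1 / (2 * α)) * ‖Kf φ‖ := by
    intro φ
    set P : Lp H 2 (volume.restrict (Ioi (0 : ℝ))) := (testFunctions.memLp φ.2).toLp φ.1 with hP
    have h1 : inner ℝ P (Kf φ) = ∫ t in Ioi 0,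
        (-inner ℝ (adjoint ι (φ.1 t)) (adjoint ι (deriv φ.1 t)) + inner ℝ (N t (φ.1 t)) (φ.1 t)) := by
      rw [L2.inner_def]
      refine integral_congr_ae ?_
      filter_upwards [(testFunctions.memLp φ.2).coeFn_toLp, (hmem φ).coeFn_toLp] with t ht1 ht2
      rw [ht1, show Kf φ = (hmem φ).toLp _ from rfl, ht2, inner_add_right, inner_neg_right,
        adjoint_inner_right, adjoint_inner_left, real_inner_comm]
    have h2 : ‖P‖ ^ 2 = ∫ t in Ioi 0, ‖φ.1 t‖ ^ 2 := by
      rw [← real_inner_self_eq_norm_sq, L2.inner_def]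
      refine integral_congr_ae ?_
      filter_upwards [(testFunctions.memLp φ.2).coeFn_toLp] with t ht1
      rw [ht1, real_inner_self_eq_norm_sq]
    have hi1 : Integrable (fun t => -inner ℝ (adjoint ι (φ.1 t)) (adjoint ι (deriv φ.1 t)))
        (volume.restrict (Ioi 0)) :=
      (((adjoint ι).comp_memLp' (testFunctions.memLp φ.2)).integrable_inner
        ((adjoint ι).comp_memLp' (testFunctions.memLp_deriv φ.2))).neg
    have hi2 : Integrable (fun t => inner ℝ (N t (φ.1 t)) (φ.1 t)) (volume.restrict (Ioi 0)) :=
      (e.memLp_clm_apply hN hK (testFunctions.memLp φ.2)).integrable_inner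
        (testFunctions.memLp φ.2)
    rw [integral_add hi1 hi2, integral_inner_deriv_eq _ φ.2] at h1
    have h3 : α * ‖P‖ ^ 2 ≤ ∫ t in Ioi 0, inner ℝ (N t (φ.1 t)) (φ.1 t) := by
      rw [h2, ← integral_const_mul]
      refine integral_mono_ae ((testFunctions.memLp φ.2).norm.integrable_sq.const_mul α) hi2 ?_
      filter_upwards [hc] with t ht using ht _
    have h4 := real_inner_le_norm P (Kf φ)
    -- From `½‖ι* φ(0)‖² + α‖φ‖² ≤ (φ, K φ) ≤ α‖φ‖² + ‖K φ‖² / (4α)`.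
    have h5 : ‖adjoint ι (φ.1 0)‖ ≤ Real.sqrt (1 / (2 * α)) * ‖Kf φ‖ := by
      refine le_of_sq_le_sq ?_ (by positivity)
      rw [mul_pow, Real.sq_sqrt (by positivity), div_mul_eq_mul_div, one_mul,
        le_div_iff₀ (by positivity)]
      nlinarith [sq_nonneg (‖Kf φ‖ - 2 * α * ‖P‖)]
    have h6 : L φ = inner ℝ z₀ (adjoint ι (φ.1 0)) := (adjoint_inner_right ι _ _).symm
    rw [h6, mul_assoc]
    exact (abs_real_inner_le_norm _ _).trans (mul_le_mul_of_nonneg_left h5 (norm_nonneg _))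
  obtain ⟨u, hu⟩ := exists_inner_eq_of_abs_le Kf L _ hbound
  refine ⟨u, Lp.memLp u, fun φ hφ => ?_⟩
  rw [← show L ⟨φ, hφ⟩ = inner ℝ (ι z₀) (φ 0) from rfl, ← hu, L2.inner_def]
  refine integral_congr_ae ?_
  filter_upwards [(hmem ⟨φ, hφ⟩).coeFn_toLp] with t ht
  rw [show Kf ⟨φ, hφ⟩ = (hmem ⟨φ, hφ⟩).toLp _ from rfl, ht, inner_add_right, inner_neg_right,
    adjoint_inner_right, ← adjoint_inner_left, ← adjoint_inner_right]

/-- A function is the primitive of its weak derivative. -/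
theorem ae_eq_primitive_of_integral_deriv_mul {p q : ℝ → ℝ} {c : ℝ}
    (hp : MemLp p 2 (volume.restrict (Ioi 0))) (hq : MemLp q 2 (volume.restrict (Ioi 0)))
    (h : ∀ ψ ∈ testFunctions ℝ, ∫ t in Ioi 0, (-(deriv ψ t * p t) - ψ t * q t) = ψ 0 * c) :
    ∀ᵐ t ∂(volume.restrict (Ioi (0 : ℝ))), p t = c + ∫ r in (0 : ℝ)..t, q r := by
  have hpi : ∀ τ, IntegrableOn p (Ioc 0 τ) := fun τ =>
    (hp.mono_measure (Measure.restrict_mono Ioc_subset_Ioi_self le_rfl)).integrable (by norm_num)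
  have hqi : ∀ τ, IntegrableOn q (Ioc 0 τ) := fun τ =>
    (hq.mono_measure (Measure.restrict_mono Ioc_subset_Ioi_self le_rfl)).integrable (by norm_num)
  set Z : ℝ → ℝ := fun t => c + ∫ r in (0 : ℝ)..max t 0, q r with hZ
  have hZc : Continuous Z := continuous_const.add (continuous_integral_max_zero fun τ _ => hqi τ)
  have hZt : ∀ t, 0 ≤ t → Z t = c + ∫ r in (0 : ℝ)..t, q r := fun t ht => by
    simp only [hZ, max_eq_left ht]
  have hloc : LocallyIntegrableOn (fun t => p t - Z t) (Ioi 0) :=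
    LocallyIntegrableOn.sub
      (locallyIntegrableOn_of_locallyIntegrable_restrict (hp.locallyIntegrable (by norm_num)))
      (hZc.locallyIntegrable.locallyIntegrableOn _)
  have key : ∀ᵐ t, t ∈ Ioi (0 : ℝ) → p t - Z t = 0 := by
    refine isOpen_Ioi.ae_eq_zero_of_integral_contDiff_smul_eq_zero hloc fun η hη hηc hηs => ?_
    obtain ⟨T, hT0, hT⟩ : ∃ T : ℝ, 0 ≤ T ∧ ∀ t, T ≤ t → η t = 0 := by
      obtain ⟨T, hT⟩ := hηc.isCompact.bddAbove
      refine ⟨max T 0 + 1, by positivity, fun t ht => image_eq_zero_of_notMem_tsupport fun h => ?_⟩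
      have := hT h
      linarith [le_max_left T 0]
    have hηI : ∀ a b, IntervalIntegrable η volume a b := hη.continuous.intervalIntegrable
    -- The primitive that vanishes for large times. Its value at `0` is free, which is how the weak
    -- formulation fixes the constant `c`.
    set ψ : ℝ → ℝ := fun t => ∫ r in T..t, η r with hψ
    have hψd : ∀ t, HasDerivAt ψ (η t) t := fun t =>
      intervalIntegral.integral_hasDerivAt_right (hηI _ _)
        (hη.continuous.stronglyMeasurableAtFilter _ _) hη.continuous.continuousAt
    have hψT : ∀ t, T ≤ t → ψ t = 0 := by
      intro t ht
      simp only [hψ]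
      rw [intervalIntegral.integral_of_le ht]
      exact setIntegral_eq_zero_of_forall_eq_zero fun x hx => hT x hx.1.le
    have hderiv : deriv ψ = η := funext fun t => (hψd t).deriv
    have hψc : ContDiff ℝ 1 ψ := contDiff_one_iff_deriv.2
      ⟨fun t => (hψd t).differentiableAt, by rw [hderiv]; exact hη.continuous⟩
    have h1 := h ψ ⟨hψc, T, hψT⟩
    rw [hderiv, setIntegral_eq_of_subset_of_forall_sdiff_eq_zero (t := Ioi 0) (s := Ioc 0 T)
      measurableSet_Ioi Ioc_subset_Ioi_self (fun t ht => by
        have : T ≤ t := (not_le.1 fun h => ht.2 ⟨ht.1, h⟩).le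
        rw [hT t this, hψT t this]; simp), ← intervalIntegral.integral_of_le hT0] at h1
    have hqI : IntervalIntegrable q volume 0 T :=
      (intervalIntegrable_iff_integrableOn_Ioc_of_le hT0).2 (hqi T)
    have hpI : IntervalIntegrable p volume 0 T :=
      (intervalIntegrable_iff_integrableOn_Ioc_of_le hT0).2 (hpi T)
    have h2 := mul_sub_mul_eq_integral_of_primitive (f := ψ) (g := Z) hT0 (hηI _ _) hqI
      (fun t _ => (intervalIntegral.integral_add_adjacent_intervals (hηI _ _) (hηI _ _)).symm)
      (fun t ht => by rw [hZt 0 le_rfl, hZt t ht.1, intervalIntegral.integral_same, add_zero])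
    rw [hψT T le_rfl, hZt 0 le_rfl, intervalIntegral.integral_same, add_zero] at h2
    have hηp : IntervalIntegrable (fun t => η t * p t) volume 0 T :=
      hpI.continuousOn_mul hη.continuous.continuousOn
    have hψq : IntervalIntegrable (fun t => ψ t * q t) volume 0 T :=
      hqI.continuousOn_mul hψc.continuous.continuousOn
    have hηZ : IntervalIntegrable (fun t => η t * Z t) volume 0 T :=
      (hη.continuous.mul hZc).intervalIntegrable _ _
    rw [intervalIntegral.integral_sub (f := fun x => -(η x * p x)) hηp.neg hψq,
      intervalIntegral.integral_neg] at h1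
    rw [intervalIntegral.integral_add hηZ hψq] at h2
    have h3 : ∫ x, η x • (p x - Z x) = ∫ x in (0 : ℝ)..T, (η x * p x - η x * Z x) := by
      rw [intervalIntegral.integral_of_le hT0]
      simp only [smul_eq_mul, mul_sub]
      refine (setIntegral_eq_integral_of_forall_compl_eq_zero fun x hx => ?_).symm
      have : η x = 0 := by
        by_contra hne
        have hx0 : 0 < x := hηs (subset_tsupport _ hne)
        exact hx ⟨hx0, le_of_not_ge fun h => hne (hT x h)⟩
      rw [this]
      simp
    rw [h3, intervalIntegral.integral_sub hηp hηZ]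
    linarith
  rw [ae_restrict_iff' measurableSet_Ioi]
  filter_upwards [key] with t ht ht0
  rw [← hZt t (le_of_lt (mem_Ioi.1 ht0))]
  exact sub_eq_zero.1 (ht ht0)

/-- Existence of a strong solution: the equation `(ι z)' + N(t) A z = 0`, `z(0) = z₀`. -/
theorem exists_strong_solution (e : HilbertBasis I ℝ H) {b : HilbertBasis I ℝ E} {s : I → ℝ}
    {ι : E →L[ℝ] H} (hs : ∀ i, 0 < s i) (hj : ∀ i, adjoint ι (e i) = s i • b i)
    (hi : Function.Injective ι) {N : ℝ → H →L[ℝ] H}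
    (hN : ∀ h k, AEMeasurable (fun t => inner ℝ (N t h) k) (volume.restrict (Ioi 0)))
    {K α : ℝ} (hK : ∀ᵐ t ∂(volume.restrict (Ioi (0 : ℝ))), ‖N t‖ ≤ K) (hα : 0 < α)
    (hc : ∀ᵐ t ∂(volume.restrict (Ioi (0 : ℝ))), ∀ h, α * ‖h‖ ^ 2 ≤ inner ℝ (N t h) h) (z₀ : E) :
    ∃ (z : ℝ → E) (u : ℝ → H), MemLp u 2 (volume.restrict (Ioi 0)) ∧ Continuous z ∧ z 0 = z₀ ∧
      (∀ t, 0 ≤ t → ι (z t) = ι z₀ + ∫ r in (0 : ℝ)..t, -(N r (u r))) ∧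
      ∀ᵐ t ∂(volume.restrict (Ioi (0 : ℝ))), z t = adjoint ι (u t) := by
  obtain ⟨u, hu, hφ⟩ := exists_memLp_primitive_eq e ι hN hK hα hc z₀
  have hNu := e.memLp_clm_apply hN hK hu
  have hSu : ∀ᵐ t ∂(volume.restrict (Ioi (0 : ℝ))),
      ι (adjoint ι (u t)) = ι z₀ + ∫ r in (0 : ℝ)..t, -(N r (u r)) := by
    have hcoord : ∀ i, ∀ᵐ t ∂(volume.restrict (Ioi (0 : ℝ))), inner ℝ (e i) (ι (adjoint ι (u t)))
        = inner ℝ (e i) (ι z₀) + ∫ r in (0 : ℝ)..t, inner ℝ (e i) (-(N r (u r))) := by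
      intro i
      refine ae_eq_primitive_of_integral_deriv_mul
        (((ι ∘L adjoint ι).comp_memLp' hu).const_inner (e i)) (hNu.neg.const_inner (e i))
        fun ψ hψ => ?_
      have hd : deriv (fun t => ψ t • e i) = fun t => deriv ψ t • e i :=
        funext fun t => ((testFunctions.differentiable hψ t).hasDerivAt.smul_const (e i)).deriv
      obtain ⟨h1, T, hT⟩ := hψ
      have h2 := hφ (fun t => ψ t • e i)
        ⟨h1.smul contDiff_const, T, fun t ht => by beta_reduce; rw [hT t ht, zero_smul]⟩
      simp only [hd, real_inner_smul_right] at h2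
      rw [real_inner_comm, ← h2]
      refine integral_congr_ae (.of_forall fun t => ?_)
      simp only [inner_neg_right, real_inner_comm (e i)]
      ring
    filter_upwards [ae_all_iff.2 hcoord, ae_restrict_mem measurableSet_Ioi] with t ht ht0
    refine e.repr.injective (lp.ext (funext fun i => ?_))
    rw [e.repr_apply_apply, e.repr_apply_apply, inner_add_right, ht i]
    congr 1
    refine (innerSL ℝ (e i)).intervalIntegral_comp_comm ?_
    rw [intervalIntegrable_iff_integrableOn_Ioc_of_le (le_of_lt (mem_Ioi.1 ht0))]
    exact (hNu.neg.mono_measure (Measure.restrict_mono Ioc_subset_Ioi_self le_rfl)).integrable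
      (by norm_num)
  obtain ⟨z, hzc, hz0, hz⟩ := exists_continuous_representative hs hj z₀ hu hNu.neg hSu
  refine ⟨z, u, hu, hzc, hz0, hz, ?_⟩
  filter_upwards [hSu, ae_restrict_mem measurableSet_Ioi] with t ht ht0
  exact hi ((hz t (le_of_lt (mem_Ioi.1 ht0))).trans ht.symm)

end Existence

/-! ### Energy decay and coercivity of the closed loop. -/

section Estimates

open ContinuousLinearMap

variable {E H : Type*}
  [NormedAddCommGroup E] [InnerProductSpace ℝ E]
  [NormedAddCommGroup H] [InnerProductSpace ℝ H]

/-- A trajectory `z`, with `u = A z` and `g = z'`, that dissipates the energy `‖z‖²`, decays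
exponentially, and its smoothing is controlled by the initial energy. -/
theorem energy_estimates [CompleteSpace E] [CompleteSpace H] {I : Type*} [Countable I]
    {e : HilbertBasis I ℝ H} {b : HilbertBasis I ℝ E} {s : I → ℝ} {ι : E →L[ℝ] H}
    (hs : ∀ i, 0 < s i) (hj : ∀ i, adjoint ι (e i) = s i • b i) {z : ℝ → E} {u g : ℝ → H}
    (hu : ∀ τ, 0 < τ → MemLp u 2 (volume.restrict (Ioc 0 τ)))
    (hg : ∀ τ, 0 < τ → MemLp g 2 (volume.restrict (Ioc 0 τ)))
    (hz : ∀ t, 0 ≤ t → ι (z t) = ι (z 0) + ∫ r in (0 : ℝ)..t, g r)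
    (hzu : ∀ᵐ t ∂(volume.restrict (Ioi (0 : ℝ))), z t = adjoint ι (u t)) {μ : ℝ} (hμ : 0 ≤ μ)
    (hdiss : ∀ᵐ t ∂(volume.restrict (Ioi (0 : ℝ))),
      1 / 4 * ‖u t‖ ^ 2 + μ * ‖adjoint ι (u t)‖ ^ 2 ≤ -inner ℝ (u t) (g t))
    {a c : ℝ} (ha : 0 ≤ a) (hac : a ≤ c) :
    ‖z c‖ ≤ Real.exp (-(μ * (c - a))) * ‖z a‖ ∧
      ∫ t in a..c, ‖u t‖ ^ 2 ≤ 2 * ‖z a‖ ^ 2 := by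
  have hsub : Ioc a c ⊆ Ioc 0 (c + 1) := fun x hx =>
    ⟨ha.trans_lt hx.1, hx.2.trans (by linarith)⟩
  have hsub' : Ioc a c ⊆ Ioi 0 := fun x hx => ha.trans_lt hx.1
  have hu2 : MemLp u 2 (volume.restrict (Ioc a c)) :=
    (hu (c + 1) (by linarith)).mono_measure (Measure.restrict_mono hsub le_rfl)
  have hg2 : MemLp g 2 (volume.restrict (Ioc a c)) :=
    (hg (c + 1) (by linarith)).mono_measure (Measure.restrict_mono hsub le_rfl)
  have hgI : ∀ x y, 0 ≤ x → 0 ≤ y → IntervalIntegrable g volume x y := by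
    intro x y hx hy
    rw [intervalIntegrable_iff]
    refine IntegrableOn.mono_set ((hg (max x y + 1) (by positivity)).integrable (by norm_num)) ?_
    exact fun r hr => ⟨(le_min hx hy).trans_lt hr.1, hr.2.trans (by simp)⟩
  have hprim : ∀ t ∈ Icc a c, ι (z t) = ι (z a) + ∫ r in a..t, g r := by
    intro t ht
    rw [hz t (ha.trans ht.1), hz a ha, add_assoc, intervalIntegral.integral_add_adjacent_intervals
      (hgI _ _ le_rfl ha) (hgI _ _ ha (ha.trans ht.1))]
  have hzu' := ae_restrict_of_ae_restrict_of_subset hsub' hzu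
  have hdiss' := ae_restrict_of_ae_restrict_of_subset hsub' hdiss
  have hi : IntegrableOn (fun r => 2 * inner ℝ (u r) (g r)) (Ioc a c) :=
    (hu2.integrable_inner hg2).const_mul 2
  have hid : ∀ t ∈ Icc a c, ‖z t‖ ^ 2 = ‖z a‖ ^ 2 + ∫ r in a..t, 2 * inner ℝ (u r) (g r) := by
    intro t ht
    have hst : Ioc a t ⊆ Ioc a c := Ioc_subset_Ioc_right ht.2
    rw [← norm_sq_sub_norm_sq_eq_integral hs hj ht.1
      (hu2.mono_measure (Measure.restrict_mono hst le_rfl))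
      (hg2.mono_measure (Measure.restrict_mono hst le_rfl))
      (fun r hr => hprim r ⟨hr.1, hr.2.trans ht.2⟩)
      (ae_restrict_of_ae_restrict_of_subset hst hzu')]
    ring
  constructor
  · have h1 := le_exp_mul_of_primitive_le (f := fun t => ‖z t‖ ^ 2) (k := 2 * μ) hac
      ((intervalIntegrable_iff_integrableOn_Ioc_of_le hac).2 hi) hid (by
        filter_upwards [hzu', hdiss'] with t h1 h2
        rw [h1]
        nlinarith [sq_nonneg ‖u t‖])
    refine le_of_sq_le_sq ?_ (by positivity)
    rw [mul_pow, ← Real.exp_nat_mul]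
    rw [show ((2 : ℕ) : ℝ) * -(μ * (c - a)) = -(2 * μ * (c - a)) by push_cast; ring]
    exact h1
  · have h1 := hid c (right_mem_Icc.2 hac)
    rw [intervalIntegral.integral_of_le hac] at h1 ⊢
    have h2 : ∫ r in Ioc a c, 2 * inner ℝ (u r) (g r) ≤ ∫ r in Ioc a c, -(1 / 2) * ‖u r‖ ^ 2 := by
      refine integral_mono_ae hi (hu2.norm.integrable_sq.const_mul _) ?_
      filter_upwards [hdiss'] with t h2
      have : 0 ≤ μ * ‖adjoint ι (u t)‖ ^ 2 := by positivity
      linarith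
    rw [integral_const_mul (-(1 / 2) : ℝ)] at h2
    nlinarith [sq_nonneg ‖z c‖]

/-- Coercivity by finitely many observations `δ i` with a biorthogonal family `χ i`: what they do
not see satisfies a Poincaré inequality, and what they see is penalised. -/
theorem mul_norm_sq_le_of_biorthogonal {ι' : Type*} [Fintype ι'] [DecidableEq ι'] (j : H →L[ℝ] E)
    (δ χ : ι' → H) (hδ : ∀ i k, inner ℝ (δ i) (χ k) = if i = k then (1 : ℝ) else 0) {κ : ℝ}
    (hκ : 0 ≤ κ) (hP : ∀ θ, (∀ i, inner ℝ (δ i) θ = (0 : ℝ)) → 8 * κ * ‖j θ‖ ^ 2 ≤ ‖θ‖ ^ 2)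
    {l : ℝ} (hl : (1 / 2 + 2 * κ * ‖j‖ ^ 2) * ∑ i, ‖χ i‖ ^ 2 ≤ l) (h : H) :
    κ * ‖j h‖ ^ 2 ≤ 1 / 2 * ‖h‖ ^ 2 + l * ∑ i, inner ℝ (δ i) h ^ 2 := by
  set S := ∑ i, inner ℝ (δ i) h ^ 2 with hS
  have hS0 : 0 ≤ S := Finset.sum_nonneg fun i _ => sq_nonneg _
  -- The oblique projection of `h` onto the span of the `χ i`, along the common kernel of the
  -- observations.
  set p : H := ∑ i, (inner ℝ (δ i) h : ℝ) • χ i with hp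
  have h1 := hP (h - p) (fun i => by
    rw [inner_sub_right, hp, inner_sum]
    simp [real_inner_smul_right, hδ])
  have hpS : ‖p‖ ^ 2 ≤ S * ∑ i, ‖χ i‖ ^ 2 := by
    have h2 : ‖p‖ ≤ ∑ i, |inner ℝ (δ i) h| * ‖χ i‖ := by
      refine (norm_sum_le _ _).trans (le_of_eq (Finset.sum_congr rfl fun i _ => ?_))
      rw [norm_smul, Real.norm_eq_abs]
    refine (pow_le_pow_left₀ (norm_nonneg _) h2 2).trans ?_
    refine (Finset.sum_mul_sq_le_sq_mul_sq _ _ _).trans (le_of_eq ?_)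
    simp only [sq_abs, hS]
  have h3 : ‖h - p‖ ^ 2 ≤ 2 * ‖h‖ ^ 2 + 2 * ‖p‖ ^ 2 := by
    have := norm_sub_le h p
    nlinarith [sq_nonneg (‖h‖ - ‖p‖), norm_nonneg (h - p), norm_nonneg h, norm_nonneg p]
  have h4 : ‖j h‖ ^ 2 ≤ 2 * ‖j (h - p)‖ ^ 2 + 2 * ‖j p‖ ^ 2 := by
    have := norm_add_le (j (h - p)) (j p)
    rw [← map_add, sub_add_cancel] at this
    nlinarith [sq_nonneg (‖j (h - p)‖ - ‖j p‖), norm_nonneg (j (h - p)), norm_nonneg (j h),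
      norm_nonneg (j p)]
  have h5 : ‖j p‖ ^ 2 ≤ ‖j‖ ^ 2 * ‖p‖ ^ 2 := by
    rw [← mul_pow]
    exact pow_le_pow_left₀ (norm_nonneg _) (j.le_opNorm p) 2
  have h6 : (1 / 2 + 2 * κ * ‖j‖ ^ 2) * ‖p‖ ^ 2 ≤ l * S := by
    refine (mul_le_mul_of_nonneg_left hpS (by positivity)).trans ?_
    calc (1 / 2 + 2 * κ * ‖j‖ ^ 2) * (S * ∑ i, ‖χ i‖ ^ 2)
        = ((1 / 2 + 2 * κ * ‖j‖ ^ 2) * ∑ i, ‖χ i‖ ^ 2) * S := by ring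
      _ ≤ l * S := mul_le_mul_of_nonneg_right hl hS0
  -- The constant 8 leaves `2κ‖j (h - p)‖² ≤ ¼‖h - p‖² ≤ ½‖h‖² + ½‖p‖²`; the terms in `p` go into
  -- `l`.
  have h7 := mul_le_mul_of_nonneg_left h4 hκ
  have h8 := mul_le_mul_of_nonneg_left h5 hκ
  nlinarith

/-- The closed-loop operator `1 + ι R + l ∑ᵢ (δᵢ, ·) δᵢ`. -/
noncomputable def closedLoop {n : ℕ} (ι : E →L[ℝ] H) (R : H →L[ℝ] E) (l : ℝ) (δ : Fin n → H) :
    H →L[ℝ] H :=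
  ContinuousLinearMap.id ℝ H + ι ∘L R + l • ∑ i, (innerSL ℝ (δ i)).smulRight (δ i)

theorem closedLoop_apply {n : ℕ} (ι : E →L[ℝ] H) (R : H →L[ℝ] E) (l : ℝ) (δ : Fin n → H) (h : H) :
    closedLoop ι R l δ h = h + ι (R h) + l • ∑ i, (inner ℝ (δ i) h : ℝ) • δ i := by
  simp [closedLoop]

theorem inner_closedLoop [CompleteSpace E] [CompleteSpace H] {n : ℕ} (ι : E →L[ℝ] H)
    (R : H →L[ℝ] E) (l : ℝ) (δ : Fin n → H) (h k : H) : inner ℝ (closedLoop ι R l δ h) k = inner ℝ h k + inner ℝ (R h) (adjoint ι k)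
      + l * ∑ i, inner ℝ (δ i) h * inner ℝ (δ i) k := by
  rw [closedLoop_apply, inner_add_left, inner_add_left, adjoint_inner_right,
    real_inner_smul_left, sum_inner]
  simp only [real_inner_smul_left]

theorem norm_closedLoop_le {n : ℕ} (ι : E →L[ℝ] H) {R : H →L[ℝ] E} {C : ℝ} (hR : ‖R‖ ≤ C) (l : ℝ)
    (δ : Fin n → H) :
    ‖closedLoop ι R l δ‖ ≤ ‖ContinuousLinearMap.id ℝ H‖ + ‖ι‖ * C
      + ‖l • ∑ i, (innerSL ℝ (δ i)).smulRight (δ i)‖ := by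
  refine (norm_add_le _ _).trans (add_le_add_left ((norm_add_le _ _).trans
    (add_le_add_right ((opNorm_comp_le _ _).trans ?_) _)) _)
  exact mul_le_mul_of_nonneg_left hR (norm_nonneg _)

/-- Young's inequality `C‖h‖‖ι* h‖ ≤ ¼‖h‖² + C²‖ι* h‖²` bounds the perturbation. Of the identity's
`‖h‖²` it takes a quarter and `hc` takes a half, so a quarter remains. -/
theorem closedLoop_coercive [CompleteSpace E] [CompleteSpace H] {n : ℕ} {ι : E →L[ℝ] H}
    {R : H →L[ℝ] E} {C μ l : ℝ} (hR : ‖R‖ ≤ C)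
    {δ : Fin n → H}
    (hc : ∀ h, (C ^ 2 + μ) * ‖adjoint ι h‖ ^ 2 ≤ 1 / 2 * ‖h‖ ^ 2 + l * ∑ i, inner ℝ (δ i) h ^ 2)
    (h : H) :
    1 / 4 * ‖h‖ ^ 2 + μ * ‖adjoint ι h‖ ^ 2 ≤ inner ℝ (closedLoop ι R l δ h) h := by
  rw [inner_closedLoop, real_inner_self_eq_norm_sq]
  simp only [← sq]
  have h1 := neg_le_of_abs_le (abs_real_inner_le_norm (R h) (adjoint ι h))
  have h2 : ‖R h‖ * ‖adjoint ι h‖ ≤ C * ‖h‖ * ‖adjoint ι h‖ :=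
    mul_le_mul_of_nonneg_right (R.le_of_opNorm_le hR h) (norm_nonneg _)
  nlinarith [hc h, sq_nonneg (1 / 2 * ‖h‖ - C * ‖adjoint ι h‖)]

end Estimates

/-! ### Distributional derivatives and primitives. -/

section Primitive

variable {F : Type*} [NormedAddCommGroup F] [InnerProductSpace ℝ F] [CompleteSpace F]

/-- A primitive has the expected distributional derivative. -/
theorem isDistribDeriv_primitive (c : F) {g : ℝ → F}
    (hg : ∀ τ, 0 < τ → IntegrableOn g (Ioc 0 τ)) :
    IsDistribDeriv (Ioi 0) (fun t => c + ∫ r in (0 : ℝ)..t, g r) g := by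
  intro φ hφ hφc hφs
  have hφ0 : φ 0 = 0 := image_eq_zero_of_notMem_tsupport fun h => lt_irrefl _ (mem_Ioi.1 (hφs h))
  obtain ⟨T, hT0, hT⟩ : ∃ T : ℝ, 0 < T ∧ ∀ t, T ≤ t → t ∉ tsupport φ := by
    obtain ⟨T, hT⟩ := hφc.isCompact.bddAbove
    refine ⟨max T 0 + 1, by positivity, fun t ht h => ?_⟩
    have := hT h
    linarith [le_max_left T 0]
  have hφT : ∀ t, T ≤ t → φ t = 0 := fun t ht => image_eq_zero_of_notMem_tsupport (hT t ht)
  have hφT' : ∀ t, T ≤ t → deriv φ t = 0 := fun t ht =>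
    image_eq_zero_of_notMem_tsupport fun h => hT t ht (tsupport_deriv_subset h)
  have hcut : ∀ {p : ℝ → F}, (∀ t, T ≤ t → p t = 0) → ∫ t in Ioi 0, p t = ∫ t in (0 : ℝ)..T, p t := by
    intro p hp
    rw [intervalIntegral.integral_of_le hT0.le]
    exact setIntegral_eq_of_subset_of_forall_sdiff_eq_zero measurableSet_Ioi Ioc_subset_Ioi_self
      fun t ht => hp t (not_le.1 fun h => ht.2 ⟨ht.1, h⟩).le
  rw [hcut fun t ht => by rw [hφT' t ht, zero_smul], hcut fun t ht => by rw [hφT t ht, zero_smul]]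
  have hgI : ∀ t, 0 ≤ t → t ≤ T → IntervalIntegrable g volume 0 t := fun t h h' =>
    (intervalIntegrable_iff_integrableOn_Ioc_of_le h).2
      ((hg T hT0).mono_set (Ioc_subset_Ioc_right h'))
  have hd : Continuous (deriv φ) := hφ.continuous_deriv (by simp)
  have hZ : ContinuousOn (fun t => c + ∫ r in (0 : ℝ)..t, g r) (uIcc 0 T) := by
    refine continuousOn_const.add ((continuous_integral_max_zero hg).continuousOn.congr ?_)
    intro t ht
    rw [uIcc_of_le hT0.le] at ht
    simp only [max_eq_left ht.1]
  have h1 : IntervalIntegrable (fun t => deriv φ t • (c + ∫ r in (0 : ℝ)..t, g r)) volume 0 T :=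
    (hd.continuousOn.smul hZ).intervalIntegrable
  have h2 : IntervalIntegrable (fun t => φ t • g t) volume 0 T :=
    (hgI T hT0.le le_rfl).continuousOn_smul hφ.continuous.continuousOn
  -- Testing against a fixed vector reduces the claim to the scalar product rule; the boundary terms
  -- vanish at `0` and at `T`.
  refine ext_inner_left ℝ fun h => ?_
  rw [inner_neg_right]
  have e1 := ((innerSL ℝ h).intervalIntegral_comp_comm h1).symm
  have e2 := ((innerSL ℝ h).intervalIntegral_comp_comm h2).symm
  simp only [innerSL_apply_apply, real_inner_smul_right] at e1 e2
  have hgh : IntervalIntegrable (fun r => inner ℝ h (g r)) volume 0 T :=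
    (intervalIntegrable_iff_integrableOn_Ioc_of_le hT0.le).2 ((hg T hT0).const_inner h)
  have e3 := mul_sub_mul_eq_integral_of_primitive (f := φ)
    (g := fun t => inner ℝ h (c + ∫ r in (0 : ℝ)..t, g r)) (p := deriv φ)
    (q := fun r => inner ℝ h (g r)) hT0.le (hd.intervalIntegrable _ _)
    hgh
    (fun t _ => by
      rw [intervalIntegral.integral_deriv_eq_sub
        (fun x _ => (hφ.differentiable (by simp)).differentiableAt) (hd.intervalIntegrable _ _)]
      ring)
    (fun t ht => by
      rw [intervalIntegral.integral_same, add_zero, inner_add_right]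
      congr 1
      exact ((innerSL ℝ h).intervalIntegral_comp_comm (hgI t ht.1 ht.2)).symm)
  rw [hφ0, hφT T le_rfl, intervalIntegral.integral_add] at e3
  · rw [e1, e2]
    linarith
  · exact (hd.continuousOn.mul (continuousOn_const.inner hZ)).intervalIntegrable
  · exact hgh.continuousOn_mul hφ.continuous.continuousOn

/-- A continuous function is the primitive of its distributional derivative. -/
theorem eq_add_integral_of_isDistribDeriv {f f₀ g : ℝ → F} (hf : ContinuousOn f (Ici 0))
    (hff : ∀ᵐ t ∂(volume.restrict (Ioi (0 : ℝ))), f t = f₀ t)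
    (hg : ∀ τ, 0 < τ → IntegrableOn g (Ioc 0 τ)) (hd : IsDistribDeriv (Ioi 0) f₀ g)
    {t : ℝ} (ht : 0 ≤ t) : f t = f 0 + ∫ r in (0 : ℝ)..t, g r := by
  have hfc : Continuous fun t => f (max t 0) :=
    hf.comp_continuous (continuous_id.max continuous_const) fun t => mem_Ici.2 (le_max_right t 0)
  have hG := continuous_integral_max_zero hg
  have key := eq_of_integral_deriv_smul_eq_zero
    (w := fun t => f (max t 0) - ∫ r in (0 : ℝ)..max t 0, g r) (hfc.sub hG) (fun φ hφ hφc hφs => by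
    have hdc : Continuous (deriv φ) := hφ.continuous_deriv (by simp)
    have hdφc : HasCompactSupport (deriv φ) := hφc.deriv
    have h1 := hd φ hφ hφc hφs
    have h2 := isDistribDeriv_primitive 0 hg φ hφ hφc hφs
    simp only [smul_sub]
    rw [integral_sub, sub_eq_zero]
    · calc ∫ t in Ioi 0, deriv φ t • f (max t 0) = ∫ t in Ioi 0, deriv φ t • f₀ t := by
            refine integral_congr_ae ?_
            filter_upwards [hff, ae_restrict_mem measurableSet_Ioi] with t ht ht0
            rw [max_eq_left (le_of_lt (mem_Ioi.1 ht0)), ht]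
        _ = ∫ t in Ioi 0, deriv φ t • (0 + ∫ r in (0 : ℝ)..t, g r) := h1.trans h2.symm
        _ = ∫ t in Ioi 0, deriv φ t • ∫ r in (0 : ℝ)..max t 0, g r := by
            refine setIntegral_congr_fun measurableSet_Ioi fun t ht0 => ?_
            simp only [zero_add, max_eq_left (le_of_lt (mem_Ioi.1 ht0))]
    · exact ((hdc.smul hfc).integrable_of_hasCompactSupport hdφc.smul_right).integrableOn
    · exact ((hdc.smul hG).integrable_of_hasCompactSupport hdφc.smul_right).integrableOn) ht
  simp only [max_eq_left ht, max_self, intervalIntegral.integral_same, sub_zero] at key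
  rw [← key, sub_add_cancel]

end Primitive

theorem IsDistribDeriv.map {X Y : Type*} [NormedAddCommGroup X] [NormedSpace ℝ X]
    [NormedAddCommGroup Y] [NormedSpace ℝ Y] (L : X ≃L[ℝ] Y) {I : Set ℝ} {f g : ℝ → X}
    (h : IsDistribDeriv I f g) : IsDistribDeriv I (fun t => L (f t)) (fun t => L (g t)) := by
  intro φ hφ hφc hφs
  have := congrArg L (h φ hφ hφc hφs)
  rw [map_neg, ← L.integral_comp_comm, ← L.integral_comp_comm] at this
  simpa only [map_smul] using this

theorem IsDistribDeriv.congr_left {Y : Type*} [NormedAddCommGroup Y] [NormedSpace ℝ Y]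
    {I : Set ℝ} {f f' g : ℝ → Y} (h : IsDistribDeriv I f g)
    (hf : ∀ᵐ t ∂(volume.restrict I), f t = f' t) : IsDistribDeriv I f' g := by
  intro φ hφ hφc hφs
  rw [← h φ hφ hφc hφs]
  refine integral_congr_ae ?_
  filter_upwards [hf] with t ht
  rw [ht]

/-! ### Strong solutions of the abstract equation. -/

section StrongSolution

open ContinuousLinearMap

variable {E H : Type*}
  [NormedAddCommGroup E] [InnerProductSpace ℝ E] [CompleteSpace E]
  [NormedAddCommGroup H] [InnerProductSpace ℝ H] [CompleteSpace H]

/-- A strong solution of `(ι z)' + N(t) u = 0`, `z = ι* u`. -/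
structure IsStrongSolution (ι : E →L[ℝ] H) (N : ℝ → H →L[ℝ] H) (z : ℝ → E) (u : ℝ → H) : Prop where
  memLp : ∀ τ, 0 < τ → MemLp u 2 (volume.restrict (Ioc 0 τ))
  primitive : ∀ t, 0 ≤ t → ι (z t) = ι (z 0) + ∫ r in (0 : ℝ)..t, -(N r (u r))
  ae_eq : ∀ᵐ t ∂(volume.restrict (Ioi (0 : ℝ))), z t = adjoint ι (u t)

variable {I : Type*} [Countable I] {e : HilbertBasis I ℝ H} {b : HilbertBasis I ℝ E} {s : I → ℝ}
  {ι : E →L[ℝ] H} {N : ℝ → H →L[ℝ] H} {K : ℝ}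

theorem IsStrongSolution.memLp_apply (e : HilbertBasis I ℝ H)
    (hN : ∀ h k, AEMeasurable (fun t => inner ℝ (N t h) k) (volume.restrict (Ioi 0)))
    (hK : ∀ᵐ t ∂(volume.restrict (Ioi (0 : ℝ))), ‖N t‖ ≤ K) {z : ℝ → E} {u : ℝ → H}
    (h : IsStrongSolution ι N z u) (τ : ℝ) (hτ : 0 < τ) :
    MemLp (fun t => -(N t (u t))) 2 (volume.restrict (Ioc 0 τ)) :=
  (e.memLp_clm_apply
    (fun x y => (hN x y).mono_measure (Measure.restrict_mono Ioc_subset_Ioi_self le_rfl))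
    (ae_restrict_of_ae_restrict_of_subset Ioc_subset_Ioi_self hK) (h.memLp τ hτ)).neg

theorem IsStrongSolution.sub (e : HilbertBasis I ℝ H)
    (hN : ∀ h k, AEMeasurable (fun t => inner ℝ (N t h) k) (volume.restrict (Ioi 0)))
    (hK : ∀ᵐ t ∂(volume.restrict (Ioi (0 : ℝ))), ‖N t‖ ≤ K) {z z' : ℝ → E} {u u' : ℝ → H}
    (h : IsStrongSolution ι N z u) (h' : IsStrongSolution ι N z' u') :
    IsStrongSolution ι N (fun t => z t - z' t) (fun t => u t - u' t) where
  memLp τ hτ := (h.memLp τ hτ).sub (h'.memLp τ hτ)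
  primitive t ht := by
    have hi : ∀ {z : ℝ → E} {u : ℝ → H}, IsStrongSolution ι N z u →
        IntervalIntegrable (fun r => -(N r (u r))) volume 0 t := by
      intro z u h
      rw [intervalIntegrable_iff_integrableOn_Ioc_of_le ht]
      exact IntegrableOn.mono_set ((h.memLp_apply e hN hK (t + 1) (by linarith)).integrable
        (by norm_num)) (Ioc_subset_Ioc_right (by linarith))
    have h1 : (fun r => -(N r (u r - u' r))) = fun r => -(N r (u r)) - -(N r (u' r)) := by
      funext r
      rw [map_sub]
      abel
    rw [h1, intervalIntegral.integral_sub (hi h) (hi h'), map_sub, map_sub, h.primitive t ht,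
      h'.primitive t ht]
    abel
  ae_eq := by
    filter_upwards [h.ae_eq, h'.ae_eq] with t h1 h2
    rw [h1, h2, map_sub]

theorem IsStrongSolution.estimates (hs : ∀ i, 0 < s i) (hj : ∀ i, adjoint ι (e i) = s i • b i)
    (hN : ∀ h k, AEMeasurable (fun t => inner ℝ (N t h) k) (volume.restrict (Ioi 0)))
    (hK : ∀ᵐ t ∂(volume.restrict (Ioi (0 : ℝ))), ‖N t‖ ≤ K) {μ : ℝ} (hμ : 0 ≤ μ)
    (hc : ∀ᵐ t ∂(volume.restrict (Ioi (0 : ℝ))), ∀ h,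
      1 / 4 * ‖h‖ ^ 2 + μ * ‖adjoint ι h‖ ^ 2 ≤ inner ℝ (N t h) h)
    {z : ℝ → E} {u : ℝ → H} (h : IsStrongSolution ι N z u) {a c : ℝ} (ha : 0 ≤ a) (hac : a ≤ c) :
    ‖z c‖ ≤ Real.exp (-(μ * (c - a))) * ‖z a‖ ∧ ∫ t in a..c, ‖u t‖ ^ 2 ≤ 2 * ‖z a‖ ^ 2 := by
  refine energy_estimates hs hj h.memLp (h.memLp_apply e hN hK) h.primitive h.ae_eq hμ ?_ ha hac
  filter_upwards [hc] with t ht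
  rw [inner_neg_right, neg_neg, real_inner_comm]
  exact ht (u t)

end StrongSolution

/-! ### Translation of the system into an equation in `H`. -/

/-- The Riesz isomorphism of a real Hilbert space, as a linear map. -/
noncomputable def realRiesz (F : Type*) [NormedAddCommGroup F] [InnerProductSpace ℝ F]
    [CompleteSpace F] : StrongDual ℝ F ≃ₗᵢ[ℝ] F where
  toFun f := (InnerProductSpace.toDual ℝ F).symm f
  invFun x := InnerProductSpace.toDual ℝ F x
  map_add' f g := map_add _ f g
  map_smul' c f := by simp
  left_inv f := by simp
  right_inv x := by simp
  norm_map' f := by simp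

theorem inner_realRiesz {F : Type*} [NormedAddCommGroup F] [InnerProductSpace ℝ F]
    [CompleteSpace F] (f : StrongDual ℝ F) (x : F) : inner ℝ (realRiesz F f) x = f x :=
  InnerProductSpace.toDual_symm_apply

namespace DiffusionOperator

open ContinuousLinearMap

variable {V H : Type*}
  [NormedAddCommGroup V] [InnerProductSpace ℝ V] [CompleteSpace V]
  [NormedAddCommGroup H] [InnerProductSpace ℝ H] [CompleteSpace H]
  (T : DiffusionOperator V H)

theorem range_VtoH : range T.VtoH = range T.incl :=
  T.ofEnergy.surjective.range_comp T.incl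

theorem denseRange_VtoH : DenseRange T.VtoH := by
  have := T.incl_denseRange
  rwa [DenseRange, ← T.range_VtoH] at this

theorem VtoH_injective : Function.Injective T.VtoH :=
  T.incl_injective.comp T.ofEnergy.injective

theorem isCompactOperator_VtoH : IsCompactOperator T.VtoH :=
  T.incl_compact.comp_clm _

/-- For the scalar product `⟨A·,·⟩`, both sides paired with `w` give `(k, w)_H`. This is why `ι*`
plays the role of `A⁻¹`. -/
theorem domToV_domAEquiv_symm (k : H) : T.domToV (T.domAEquiv.symm k) = adjoint T.VtoH k := by
  refine ext_inner_right ℝ fun w => ?_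
  rw [adjoint_inner_left, energy_inner]
  refine (T.inner_domA _ _).symm.trans ?_
  congr 1
  exact T.domAEquiv.apply_symm_apply k

theorem realRiesz_HtoDualV (h : H) : realRiesz T.Energy (T.HtoDualV h) = adjoint T.VtoH h := by
  refine ext_inner_right ℝ fun w => ?_
  rw [inner_realRiesz, adjoint_inner_left]
  rfl

/-- `D(A)'` is identified with `H` through `⟨f, A⁻¹ k⟩ = (Θ f, k)_H`. -/
noncomputable def dualDomEquiv : T.DualDom ≃L[ℝ] H :=
  (T.domAEquiv.toContinuousLinearEquiv.arrowCongr (ContinuousLinearEquiv.refl ℝ ℝ)).trans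
    (realRiesz H).toContinuousLinearEquiv

theorem inner_dualDomEquiv (f : T.DualDom) (k : H) :
    inner ℝ (T.dualDomEquiv f) k = f (T.domAEquiv.symm k) :=
  inner_realRiesz _ _

theorem dualDomEquiv_dualVToDualDom (f : T.DualV) :
    T.dualDomEquiv (T.dualVToDualDom f) = T.VtoH (realRiesz T.Energy f) := by
  refine ext_inner_right ℝ fun k => ?_
  rw [inner_dualDomEquiv, ← adjoint_inner_right, inner_realRiesz, ← domToV_domAEquiv_symm]
  rfl

theorem dualDomEquiv_HtoDualDom (h : H) :
    T.dualDomEquiv (T.HtoDualDom h) = T.VtoH (adjoint T.VtoH h) := by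
  rw [← realRiesz_HtoDualV, ← dualDomEquiv_dualVToDualDom]
  rfl

theorem dualDomEquiv_AHtoDualDom (h : H) : T.dualDomEquiv (T.AHtoDualDom h) = h := by
  refine ext_inner_right ℝ fun k => ?_
  rw [inner_dualDomEquiv]
  exact congrArg (inner ℝ h) (T.domAEquiv.apply_symm_apply k)

/-- The operator `k ↦ A_rc k + A k + λ ∑ⱼ ⟨dⱼ, A⁻¹ k⟩ dⱼ`, read in `H`. -/
noncomputable def loop (Arc : ℝ → H →L[ℝ] T.DualV) (lam : ℝ) {n : ℕ} (d : Fin n → T.DualDom)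
    (t : ℝ) : H →L[ℝ] H :=
  closedLoop T.VtoH ((realRiesz T.Energy).toContinuousLinearEquiv.toContinuousLinearMap ∘L Arc t)
    lam fun i => T.dualDomEquiv (d i)

theorem dualDomEquiv_symm_loop (Arc : ℝ → H →L[ℝ] T.DualV) (lam : ℝ) {n : ℕ}
    (d : Fin n → T.DualDom) (t : ℝ) (h : H) :
    T.dualDomEquiv.symm (T.loop Arc lam d t h) = T.AHtoDualDom h + T.dualVToDualDom (Arc t h)
      + lam • ∑ j, d j (T.domAEquiv.symm h) • d j := by
  rw [ContinuousLinearEquiv.symm_apply_eq, map_add, map_add, map_smul, map_sum,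
    dualDomEquiv_AHtoDualDom, dualDomEquiv_dualVToDualDom]
  simp only [map_smul, ← inner_dualDomEquiv]
  exact closedLoop_apply _ _ _ _ _

theorem aemeasurable_inner_loop {Arc : ℝ → H →L[ℝ] T.DualV} {C : ℝ}
    (hA : T.IsReactionConvection Arc C) (lam : ℝ) {n : ℕ} (d : Fin n → T.DualDom) (h k : H) :
    AEMeasurable (fun t => inner ℝ (T.loop Arc lam d t h) k) (volume.restrict (Ioi 0)) := by
  simp only [loop, inner_closedLoop]
  refine (AEMeasurable.add aemeasurable_const ?_).add aemeasurable_const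
  exact (hA.aemeasurable h (adjoint T.VtoH k)).congr
    (.of_forall fun t => (inner_realRiesz (Arc t h) _).symm)

theorem norm_realRiesz_comp (R : H →L[ℝ] T.DualV) :
    ‖(realRiesz T.Energy).toContinuousLinearEquiv.toContinuousLinearMap ∘L R‖ = ‖R‖ :=
  LinearIsometry.norm_toContinuousLinearMap_comp (realRiesz T.Energy).toLinearIsometry

theorem exists_norm_loop_le {Arc : ℝ → H →L[ℝ] T.DualV} {C : ℝ}
    (hA : T.IsReactionConvection Arc C) (lam : ℝ) {n : ℕ} (d : Fin n → T.DualDom) :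
    ∃ K, ∀ᵐ t ∂(volume.restrict (Ioi (0 : ℝ))), ‖T.loop Arc lam d t‖ ≤ K := by
  refine ⟨_, hA.bound.mono fun t ht => norm_closedLoop_le (C := C) T.VtoH ?_ _ _⟩
  rwa [norm_realRiesz_comp]

theorem loop_coercive {Arc : ℝ → H →L[ℝ] T.DualV} {C μ lam : ℝ}
    (hA : T.IsReactionConvection Arc C) {n : ℕ} {d : Fin n → T.DualDom}
    (hc : ∀ h, (C ^ 2 + μ) * ‖adjoint T.VtoH h‖ ^ 2
      ≤ 1 / 2 * ‖h‖ ^ 2 + lam * ∑ i, inner ℝ (T.dualDomEquiv (d i)) h ^ 2) :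
    ∀ᵐ t ∂(volume.restrict (Ioi (0 : ℝ))), ∀ h,
      1 / 4 * ‖h‖ ^ 2 + μ * ‖adjoint T.VtoH h‖ ^ 2 ≤ inner ℝ (T.loop Arc lam d t h) h :=
  hA.bound.mono fun t ht h => closedLoop_coercive (by rwa [norm_realRiesz_comp]) hc h

/-- The Poincaré inequality behind `poincareConst`. -/
theorem mul_norm_sq_le_of_le_poincareConst {n : ℕ} {d : Fin n → T.DualDom} {k : ℝ}
    (hk : k ≤ T.poincareConst d) {h : H} (hh : ∀ i, inner ℝ (T.dualDomEquiv (d i)) h = (0 : ℝ)) :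
    k * ‖adjoint T.VtoH h‖ ^ 2 ≤ ‖h‖ ^ 2 := by
  rcases eq_or_ne h 0 with rfl | h0
  · simp
  have hne : T.domAEquiv.symm h ≠ 0 := fun e => h0 (by
    rw [← T.domAEquiv.apply_symm_apply h, e, map_zero])
  have hle : T.poincareConst d
      ≤ ‖T.domAEquiv.symm h‖ ^ 2 / ‖T.domToV (T.domAEquiv.symm h)‖ ^ 2 :=
    ciInf_le (f := fun Θ : {Θ : T.Dom // (∀ j, d j Θ = 0) ∧ Θ ≠ 0} =>
        ‖Θ.1‖ ^ 2 / ‖T.domToV Θ.1‖ ^ 2)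
      ⟨0, by rintro _ ⟨Θ, rfl⟩; positivity⟩
      ⟨T.domAEquiv.symm h, fun j => by rw [← inner_dualDomEquiv, hh], hne⟩
  rw [domToV_domAEquiv_symm, LinearIsometryEquiv.norm_map] at hle
  have hpos : 0 < ‖adjoint T.VtoH h‖ := norm_pos_iff.2 fun e => h0
    (T.denseRange_VtoH.adjoint_injective (e.trans (map_zero _).symm))
  exact (le_div_iff₀ (by positivity)).1 (hk.trans hle)

/-- A solution of the system is a strong solution for the variable `A⁻¹ y`. -/
theorem IsSolution.isStrongSolution {Arc : ℝ → H →L[ℝ] T.DualV} {lam : ℝ} {n : ℕ}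
    {d : Fin n → T.DualDom} {y₀ : T.DualV} {y : ℝ → T.DualV} {yH : ℝ → H}
    (h : T.IsSolution Arc lam d y₀ y yH) :
    IsStrongSolution T.VtoH (T.loop Arc lam d) (fun t => realRiesz T.Energy (y t)) yH := by
  obtain ⟨y', hy', hd, heq⟩ := h.equation
  have hae : ∀ᵐ t ∂(volume.restrict (Ioi (0 : ℝ))),
      realRiesz T.Energy (y t) = adjoint T.VtoH (yH t) := by
    filter_upwards [h.ae_eq] with t ht
    rw [ht, realRiesz_HtoDualV]
  have hg : ∀ᵐ t ∂(volume.restrict (Ioi (0 : ℝ))),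
      T.dualDomEquiv (y' t) = -(T.loop Arc lam d t (yH t)) := by
    filter_upwards [heq] with t ht
    rw [← ContinuousLinearEquiv.eq_symm_apply, map_neg, dualDomEquiv_symm_loop]
    rw [← sub_eq_zero] at ht ⊢
    rw [← ht]
    abel
  have hres : ∀ τ : ℝ, (volume.restrict (Ioo 0 τ)) = volume.restrict (Ioc 0 τ) :=
    fun τ => Measure.restrict_congr_set Ioo_ae_eq_Ioc
  refine ⟨fun τ hτ => hres τ ▸ h.memLp τ hτ, fun t ht => ?_, hae⟩
  have h1 := eq_add_integral_of_isDistribDeriv (f := fun t => T.VtoH (realRiesz T.Energy (y t)))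
    (f₀ := fun t => T.dualDomEquiv (T.HtoDualDom (yH t))) (g := fun t => T.dualDomEquiv (y' t))
    (T.VtoH.continuous.comp_continuousOn
      ((realRiesz T.Energy).continuous.comp_continuousOn h.continuousOn))
    (by
      filter_upwards [hae] with t ht
      rw [ht, dualDomEquiv_HtoDualDom])
    (fun τ hτ => by
      have := hy' τ hτ
      rw [hres] at this
      exact (T.dualDomEquiv.toContinuousLinearMap.comp_memLp' this).integrable (by norm_num))
    (hd.map T.dualDomEquiv) ht
  refine h1.trans ?_
  congr 1
  rw [intervalIntegral.integral_of_le ht, intervalIntegral.integral_of_le ht]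
  exact integral_congr_ae (ae_restrict_of_ae_restrict_of_subset Ioc_subset_Ioi_self hg)

/-- Well-posedness of the closed-loop system, and exponential stability, under a coercivity
condition. -/
theorem exists_solution_of_coercive {Arc : ℝ → H →L[ℝ] T.DualV} {C μ lam : ℝ} (hμ : 0 ≤ μ)
    (hA : T.IsReactionConvection Arc C) {n : ℕ} {d : Fin n → T.DualDom}
    (hc : ∀ h, (C ^ 2 + μ) * ‖adjoint T.VtoH h‖ ^ 2
      ≤ 1 / 2 * ‖h‖ ^ 2 + lam * ∑ i, inner ℝ (T.dualDomEquiv (d i)) h ^ 2) (y₀ : T.DualV) :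
    ∃ (y : ℝ → T.DualV) (yH : ℝ → H),
      T.IsSolution Arc lam d y₀ y yH ∧
      (∀ (w : ℝ → T.DualV) (wH : ℝ → H), T.IsSolution Arc lam d y₀ w wH → EqOn w y (Ici 0)) ∧
      MemW T.HtoDualDom (Ioi 0) yH ∧
      (∀ s t : ℝ, 0 ≤ s → s ≤ t → ‖y t‖ ≤ Real.exp (-(μ * (t - s))) * ‖y s‖) ∧
      ∀ s : ℝ, 0 ≤ s → ∫ t in Ioi s, ‖yH t‖ ^ 2 ≤ 2 * ‖y s‖ ^ 2 := by
  obtain ⟨I, hI, e, b, s, hs, hj⟩ :=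
    T.isCompactOperator_VtoH.exists_hilbertBasis T.denseRange_VtoH T.VtoH_injective
  obtain ⟨K, hK⟩ := T.exists_norm_loop_le hA lam d
  have hN := T.aemeasurable_inner_loop hA lam d
  have hco := T.loop_coercive hA hc
  obtain ⟨z, u, hu, hzc, hz0, hz, hzu⟩ := exists_strong_solution e hs hj T.VtoH_injective hN hK
    (α := 1 / 4) (by norm_num) (by
      filter_upwards [hco] with t ht h
      have := ht h
      have : 0 ≤ μ * ‖adjoint T.VtoH h‖ ^ 2 := by positivity
      linarith) (realRiesz T.Energy y₀)
  have hNu := (e.memLp_clm_apply hN hK hu).neg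
  set g : ℝ → T.DualDom := fun t => T.dualDomEquiv.symm (-(T.loop Arc lam d t (u t))) with hg
  have hg2 : MemLp g 2 (volume.restrict (Ioi 0)) :=
    T.dualDomEquiv.symm.toContinuousLinearMap.comp_memLp' hNu
  have hgd : IsDistribDeriv (Ioi 0) (fun t => T.HtoDualDom (u t)) g := by
    refine ((isDistribDeriv_primitive (T.VtoH (realRiesz T.Energy y₀)) fun τ _ =>
      (hNu.mono_measure (Measure.restrict_mono Ioc_subset_Ioi_self le_rfl)).integrable
        (by norm_num)).map T.dualDomEquiv.symm).congr_left ?_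
    filter_upwards [hzu, ae_restrict_mem measurableSet_Ioi] with t ht ht0
    rw [ContinuousLinearEquiv.symm_apply_eq, dualDomEquiv_HtoDualDom, ← ht]
    exact (hz t (le_of_lt (mem_Ioi.1 ht0))).symm
  have hsol : T.IsSolution Arc lam d y₀ (fun t => (realRiesz T.Energy).symm (z t)) u :=
    { continuousOn := ((realRiesz T.Energy).symm.continuous.comp hzc).continuousOn
      initial := by simp [hz0]
      ae_eq := by
        filter_upwards [hzu] with t ht
        rw [ht, ← realRiesz_HtoDualV, LinearIsometryEquiv.symm_apply_apply]
      memLp := fun τ _ => hu.mono_measure (Measure.restrict_mono Ioo_subset_Ioi_self le_rfl)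
      equation := by
        refine ⟨g, fun τ _ => hg2.mono_measure (Measure.restrict_mono Ioo_subset_Ioi_self le_rfl),
          hgd, .of_forall fun t => ?_⟩
        rw [hg]
        beta_reduce
        rw [map_neg, dualDomEquiv_symm_loop]
        abel }
  have hstr := hsol.isStrongSolution
  have hest := fun {w : ℝ → T.Energy} {wH : ℝ → H}
    (h : IsStrongSolution T.VtoH (T.loop Arc lam d) w wH) {a c : ℝ} (ha : 0 ≤ a) (hac : a ≤ c) =>
    h.estimates hs hj hN hK hμ hco ha hac
  refine ⟨_, u, hsol, fun w wH hw t ht => ?_, ⟨hu, g, hg2, hgd⟩, fun a c ha hac => ?_,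
    fun a ha => ?_⟩
  -- Uniqueness: the difference of two solutions is a strong solution starting from `0`, so the
  -- decay estimate annihilates it.
  · have h1 := (hest (hw.isStrongSolution.sub e hN hK hstr) le_rfl (mem_Ici.1 ht)).1
    beta_reduce at h1
    rw [hw.initial, hsol.initial, sub_self, norm_zero, mul_zero, norm_le_zero_iff, ← map_sub,
      map_eq_zero_iff _ (realRiesz T.Energy).injective] at h1
    exact sub_eq_zero.1 h1
  · have h1 := (hest hstr ha hac).1
    simpa only [LinearIsometryEquiv.norm_map] using h1
  · have hint : IntegrableOn (fun t => ‖u t‖ ^ 2) (Ioi a) :=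
      IntegrableOn.mono_set hu.norm.integrable_sq (Ioi_subset_Ioi ha)
    refine le_of_tendsto (intervalIntegral_tendsto_integral_Ioi a hint tendsto_id) ?_
    filter_upwards [eventually_ge_atTop a] with c hac
    have h1 := (hest hstr ha hac).2
    simpa only [LinearIsometryEquiv.norm_map, id] using h1

end DiffusionOperator

/-! ### Monotone thresholds and conclusion. -/

/-- A sequence that tends to infinity stays above any level from a monotone threshold on. -/
theorem exists_monotone_threshold {ξ : ℕ+ → ℝ} (h : Tendsto ξ atTop atTop) :
    ∃ m : ℕ → ℕ+, Monotone m ∧ ∀ k M, m k ≤ M → (k : ℝ) ≤ ξ M := by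
  choose f hf using fun k : ℕ => eventually_atTop.1 (h.eventually_ge_atTop (k : ℝ))
  exact ⟨partialSups f, (partialSups f).monotone, fun k M hM =>
    hf k M ((le_partialSups f k).trans hM)⟩

theorem theorem3p1 {V H : Type*}
    [NormedAddCommGroup V] [InnerProductSpace ℝ V] [CompleteSpace V]
    [NormedAddCommGroup H] [InnerProductSpace ℝ H] [CompleteSpace H]
    (T : DiffusionOperator V H) (σ : ℕ+ → ℕ+) (d : (M : ℕ+) → Fin (σ M) → T.DualDom)
    (hd : T.IsActuatorSequence σ d) :
    ∃ (Mbar : ℝ≥0 × ℝ≥0 → ℕ+) (lamBar : ℕ+ × ℝ≥0 × ℝ≥0 → ℝ),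
      Monotone Mbar ∧ Monotone lamBar ∧ (∀ p, 0 < lamBar p) ∧
      ∀ (μ C : ℝ≥0), 0 < μ →
      ∀ Arc : ℝ → H →L[ℝ] T.DualV, T.IsReactionConvection Arc C →
      ∀ M : ℕ+, Mbar (μ, C) ≤ M → ∀ lam : ℝ, lamBar (M, μ, C) ≤ lam →
      ∀ y₀ : T.DualV,
        ∃ (y : ℝ → T.DualV) (yH : ℝ → H),
          T.IsSolution Arc lam (d M) y₀ y yH ∧
          (∀ (w : ℝ → T.DualV) (wH : ℝ → H),
            T.IsSolution Arc lam (d M) y₀ w wH → EqOn w y (Ici 0)) ∧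
          MemW T.HtoDualDom (Ioi 0) yH ∧
          (∀ s t : ℝ, 0 ≤ s → s ≤ t → ‖y t‖ ≤ Real.exp (-(μ * (t - s))) * ‖y s‖) ∧
          (∀ s : ℝ, 0 ≤ s →
            ∫ t in Ioi s, ‖yH t‖ ^ 2 ≤ (2 + (μ : ℝ)⁻¹ * (C : ℝ) ^ 2) * ‖y s‖ ^ 2) := by
  obtain ⟨m, hm, hξ⟩ := exists_monotone_threshold hd.tendsto_poincareConst
  obtain ⟨Ψ, -, hΨ⟩ := hd.exists_auxiliary
  set Q : ℕ+ → ℝ := fun M => ∑ i, ‖T.domAEquiv (Ψ M i)‖ ^ 2 with hQ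
  have hQ0 : ∀ M, 0 ≤ Q M := fun M => Finset.sum_nonneg fun i _ => sq_nonneg _
  set J : ℝ := ‖ContinuousLinearMap.adjoint T.VtoH‖ with hJ
  set κ : ℝ≥0 × ℝ≥0 → ℝ≥0 := fun p => p.2 ^ 2 + p.1 with hκ
  have hκm : Monotone κ := fun p q hpq => add_le_add (pow_le_pow_left' hpq.2 2) hpq.1
  -- `Q` need not be monotone in `M`; its partial sums are, and they dominate it.
  set G : ℕ+ → ℝ := fun M => ∑ k ∈ Finset.Icc 1 M, Q k with hG
  have hG0 : ∀ M, 0 ≤ G M := fun M => Finset.sum_nonneg fun i _ => hQ0 i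
  have hGm : Monotone G := fun M M' hM =>
    Finset.sum_le_sum_of_subset_of_nonneg (Finset.Icc_subset_Icc_right hM) fun i _ _ => hQ0 i
  -- With `κ = C² + μ`, these are the two thresholds of `mul_norm_sq_le_of_biorthogonal`; the
  -- summand 1 only ensures positivity.
  refine ⟨fun p => m ⌈8 * (κ p : ℝ)⌉₊, fun p => 1 + (1 / 2 + 2 * (κ p.2 : ℝ) * J ^ 2) * G p.1,
    fun p q hpq => hm (Nat.ceil_mono ?_), fun p q hpq => ?_, fun p => ?_, ?_⟩
  · have : (κ p : ℝ) ≤ κ q := NNReal.coe_le_coe.2 (hκm hpq)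
    linarith
  · have h1 : (κ p.2 : ℝ) ≤ κ q.2 := NNReal.coe_le_coe.2 (hκm hpq.2)
    have h2 := hGm hpq.1
    have h3 := hG0 p.1
    beta_reduce
    gcongr
  · have h1 := hG0 p.1
    positivity
  intro μ C hμ Arc hA M hM lam hlam y₀
  have hc : ∀ h, ((C : ℝ) ^ 2 + μ) * ‖ContinuousLinearMap.adjoint T.VtoH h‖ ^ 2
      ≤ 1 / 2 * ‖h‖ ^ 2 + lam * ∑ i, inner ℝ (T.dualDomEquiv (d M i)) h ^ 2 := by
    intro h
    refine mul_norm_sq_le_of_biorthogonal (ContinuousLinearMap.adjoint T.VtoH)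
      (fun i => T.dualDomEquiv (d M i)) (fun i => T.domAEquiv (Ψ M i)) (fun i k => ?_)
      (by positivity) (fun θ hθ => ?_) (le_trans ?_ hlam) h
    · rw [T.inner_dualDomEquiv, LinearIsometryEquiv.symm_apply_apply, hΨ]
    · refine T.mul_norm_sq_le_of_le_poincareConst ?_ hθ
      refine le_trans ?_ (hξ _ M hM)
      refine le_trans (le_of_eq ?_) (Nat.le_ceil _)
      simp [hκ]
    · have h1 : Q M ≤ G M := Finset.single_le_sum (f := Q) (fun i _ => hQ0 i)
        (Finset.mem_Icc.2 ⟨one_le, le_rfl⟩)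
      have h2 : ((κ (μ, C) : ℝ≥0) : ℝ) = (C : ℝ) ^ 2 + μ := by simp [hκ]
      change (1 / 2 + 2 * ((C : ℝ) ^ 2 + μ) * J ^ 2) * Q M
        ≤ 1 + (1 / 2 + 2 * (κ (μ, C) : ℝ) * J ^ 2) * G M
      rw [h2]
      have h3 : (1 / 2 + 2 * ((C : ℝ) ^ 2 + μ) * J ^ 2) * Q M
          ≤ (1 / 2 + 2 * ((C : ℝ) ^ 2 + μ) * J ^ 2) * G M :=
        mul_le_mul_of_nonneg_left h1 (by positivity)
      linarith
  obtain ⟨y, yH, h1, h2, h3, h4, h5⟩ := T.exists_solution_of_coercive μ.2 hA hc y₀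
  -- The smoothing estimate already holds with the constant 2.
  refine ⟨y, yH, h1, h2, h3, h4, fun s hs => (h5 s hs).trans ?_⟩
  refine mul_le_mul_of_nonneg_right ?_ (sq_nonneg _)
  have : 0 ≤ (μ : ℝ)⁻¹ * (C : ℝ) ^ 2 := by positivity
  linarith
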